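/- **Setting.** Let $N\ge 1$, $d\in\{1,2,3\}$, and let $\mathcal W\in L^1_{\mathrm{loc}}(\mathbb R^{dN};\mathbb R_+)$; write $X=(x_1,\dots,x_N)\in\mathbb R^{dN}$. Let $\mathfrak h$ be a separable complex Hilbert space, $\omega\ge 0$ an injective self-adjoint (possibly unbounded) operator on $\mathfrak h$, and let $\mathfrak h_\omega$ be the completion of $\bigcap_{k}\mathscr D(\omega^k)$ for the scalar product $\langle\cdot|\omega|\cdot\rangle_{\mathfrak h}$, so that $\langle z|\omega|z\rangle=\|z\|^2_{\mathfrak h_\omega}$. If $f\in\mathscr D(\omega^{-1/2})$, then $z\mapsto\langle z|f\rangle_{\mathfrak h}$ extends by continuity to $\mathfrak h_\omega$. Consider one of the following energy functionals $\mathcal E_{\mathrm{qc}}[\psi,z]=\langle\psi|\mathcal H_z|\psi\rangle_{L^2(\mathbb R^{dN})}$, understood as a quadratic form on $\psi\in H^1(\mathbb R^{dN})$, $\int\mathcal W|\psi|^2<\infty$, and equal to $+\infty$ for all other $\psi\in L^2(\mathbb R^{dN})$, where $z\in\mathfrak h_\omega$: (a) *Nelson model*: $\mathcal H_z=\sum_{j}\big(-\Delta_j+2\,\mathrm{Re}\langle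 z|\lambda(x_j)\rangle_{\mathfrak h}\big)+\mathcal W+\langle z|\omega|z\rangle$ with $\lambda,\ \omega^{-1/2}\lambda\in L^\infty(\mathbb R^d;\mathfrak h)$. (b) *Polaron*: $\mathfrak h=\mathfrak h_\omega=L^2(\mathbb R^d)$, $\omega=1$, and $\mathcal H_z=\sum_j\big(-\Delta_j+\mathcal V_z(x_j)\big)+\mathcal W+\|z\|^2$ with formally $\mathcal V_z(x)=2\,\mathrm{Re}\langle z|\lambda(x)\rangle$, $\lambda(x;k)=\sqrt\alpha\,e^{-ik\cdot x}|k|^{-(d-1)/2}$, $\alpha>0$. This means $\mathcal V_z=\mathcal V_{<,z}+\nabla\cdot\mathbf b_z$ for a cut-off $\varrho>0$, where $$\mathcal V_{<,z}(x)=2\,\mathrm{Re}\int_{|k|\le\varrho}\overline{z(k)}\,\sqrt\alpha\,|k|^{-\frac{d-1}2}e^{-ik\cdot x}\,dk,\qquad \mathbf b_z(x)=-2\,\mathrm{Im}\int_{|k|>\varrho}\overline{z(k)}\,\sqrt\alpha\,|k|^{-\frac{d+1}2}\tfrac{k}{|k|}e^{-ik\cdot x}\,dk,$$ and $\langle\psi|(\nabla\cdot\mathbf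 b_z)(x_j)|\psi\rangle:=-2\,\mathrm{Re}\int\mathbf b_z(x_j)\cdot\overline{\psi}\,\nabla_j\psi\,dX$. (c) *Pauli–Fierz model* ($d=3$): $\mathcal H_z=\sum_j\frac1{2m_j}\big(-i\nabla_j+e\,\mathbf a_{z,j}(x_j)\big)^2+\mathcal W+\langle z|\omega|z\rangle$, $\mathbf a_{z,j}(x)=2\,\mathrm{Re}\langle z|\boldsymbol\lambda_j(x)\rangle_{\mathfrak h}$, with $m_j>0$, $e\in\mathbb R$, $\lambda_{j,\ell},\ \omega^{\pm1/2}\lambda_{j,\ell}\in L^\infty(\mathbb R^3;\mathfrak h)$ for $\ell=1,2,3$, and $\nabla\cdot\boldsymbol\lambda_j=0$ in the sense of distributions. **Variational problems.** All infima are taken in $[-\infty,+\infty]$. * $E_{\mathrm{qc}}=\inf\{\mathcal E_{\mathrm{qc}}[\psi,z]:\ \|\psi\|_2=1,\ z\in\mathfrak h_\omega,\ |\mathcal E_{\mathrm{qc}}[\psi,z]|<\infty\}$. * A state-valued probability measure is a Borel measure $\mathfrak m$ on $\mathfrak h_\omega$ with values in the positive trace class operators on $L^2(\mathbb R^{dN})$,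 countably additive in trace norm, with $\mathrm{tr}\,\mathfrak m(\mathfrak h_\omega)=1$. Let $\mu_{\mathfrak m}(S)=\mathrm{tr}\,\mathfrak m(S)$ and let $\gamma_{\mathfrak m}$, with values in the density matrices of trace one, be its Radon–Nikodym derivative: $d\mathfrak m=\gamma_{\mathfrak m}\,d\mu_{\mathfrak m}$. Then $\mathcal E_{\mathrm{svm}}[\mathfrak m]=\int d\mu_{\mathfrak m}(z)\,\mathrm{tr}[\gamma_{\mathfrak m}(z)\mathcal H_z]$, where $\mathrm{tr}[\gamma\mathcal H_z]=\sum_kp_k\,\mathcal E_{\mathrm{qc}}[\psi_k,z]$ if $\gamma=\sum_kp_k|\psi_k\rangle\langle\psi_k|$ with $p_k\ge0$ and $(\psi_k)$ orthonormal, and $E_{\mathrm{svm}}$ is the infimum of $\mathcal E_{\mathrm{svm}}[\mathfrak m]$ over all $\mathfrak m$ with $|\mathcal E_{\mathrm{svm}}[\mathfrak m]|<\infty$. Let $E_{\mathrm{svm}}^{\mathrm{atom}}$ be the infimum over those $\mathfrak m$ that are moreover supported on finitely many points. * $E_{\mathrm{pm}}$ is the infimum of $\mathcal E_{\mathrm{pm}}[\psi,\mu]=\int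 d\mu(z)\,\mathcal E_{\mathrm{qc}}[\psi,z]$ over $\|\psi\|_2=1$ and Borel probability measures $\mu$ on $\mathfrak h_\omega$ with $|\mathcal E_{\mathrm{pm}}[\psi,\mu]|<\infty$, and $E_{\mathrm{pm}}^{\mathrm{atom}}$ is the same infimum restricted to $\mu$ supported on finitely many points. * $E_{\mathrm{Pekar}}=\inf\{\mathcal E_{\mathrm{Pekar}}[\psi]:\ \|\psi\|_2=1,\ |\mathcal E_{\mathrm{Pekar}}[\psi]|<\infty\}$, where $\mathcal E_{\mathrm{Pekar}}[\psi]=\inf_{z\in\mathfrak h_\omega}\mathcal E_{\mathrm{qc}}[\psi,z]$; and $E_{\mathrm{Pekar}}^{\mathrm{impl}}$ is the same infimum for the Pekar functional in its implicit form, $\psi\mapsto\mathcal E_{\mathrm{qc}}[\psi,z_\psi]$, where $z_\psi\in\mathfrak h_\omega$ is the critical point of $z\mapsto\mathcal E_{\mathrm{qc}}[\psi,z]$, i.e. $\frac{d}{dt}\mathcal E_{\mathrm{qc}}[\psi,z_\psi+t\zeta]\big|_{t=0}=0$ for all $\zeta\in\mathfrak h_\omega$. * $\mathcal I[z]=\inf_{\|\psi\|_2=1}\mathcal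 E_{\mathrm{qc}}[\psi,z]$ for $z\in\mathfrak h_\omega$. **Proposition (Quasi-classical energies).** In each of the three models, $$E_{\mathrm{qc}}=E_{\mathrm{svm}}=E_{\mathrm{svm}}^{\mathrm{atom}}=E_{\mathrm{pm}}=E_{\mathrm{pm}}^{\mathrm{atom}}=E_{\mathrm{Pekar}}=E_{\mathrm{Pekar}}^{\mathrm{impl}}=\inf_{z\in\mathfrak h_\omega}\mathcal I[z].$$ -/

import Mathlib

noncomputable section

namespace QuasiClassical

open MeasureTheory Filter Topology
open scoped ENNReal InnerProductSpace

/-! ### Extended integrals, trace norm, traces -/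

/-- An extended real number is finite. -/
def IsFinite (x : EReal) : Prop := x ≠ ⊤ ∧ x ≠ ⊥

/-- The integral of an extended real function, i.e. the integral of its positive part minus the
integral of its negative part. -/
def extIntegral {Z : Type*} [MeasurableSpace Z] (μ : Measure Z) (f : Z → EReal) : EReal :=
  ((∫⁻ z, (f z).toENNReal ∂μ : ℝ≥0∞) : EReal) - ((∫⁻ z, (-f z).toENNReal ∂μ : ℝ≥0∞) : EReal)

section Operators

variable {H : Type*} [NormedAddCommGroup H] [InnerProductSpace ℂ H]

/-- The trace norm of a bounded operator, in its variational form
`sup |∑ ⟨uᵢ, A vᵢ⟩|` over finite orthonormal families; it is `⊤` iff `A` is not trace class, and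
it is the trace of `A` if `A ≥ 0`. -/
def traceNorm (A : H →L[ℂ] H) : ℝ≥0∞ :=
  ⨆ (n : ℕ) (u : Fin n → H) (v : Fin n → H) (_ : Orthonormal ℂ u) (_ : Orthonormal ℂ v),
    ‖∑ i, ⟪u i, A (v i)⟫_ℂ‖ₑ

/-- Normalized density matrices: positive trace class operators of trace one. -/
def IsDensityMatrix [CompleteSpace H] (γ : H →L[ℂ] H) : Prop :=
  γ.IsPositive ∧ traceNorm γ = 1

/-- `γ = ∑ₖ pₖ |ψₖ⟩⟨ψₖ|` with `pₖ ≥ 0` and `ψₖ` orthonormal. -/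
structure IsSpectralDecomposition (γ : H →L[ℂ] H) (p : ℕ → ℝ) (ψ : ℕ → H) : Prop where
  nonneg : ∀ k, 0 ≤ p k
  orthonormal : Orthonormal ℂ ψ
  hasSum : ∀ φ : H, HasSum (fun k => ((p k : ℂ) * ⟪ψ k, φ⟫_ℂ) • ψ k) (γ φ)

/-- `tr[γ Q] = ∑ₖ pₖ Q[ψₖ]` for a density matrix `γ = ∑ₖ pₖ |ψₖ⟩⟨ψₖ|` and a quadratic form `Q`,
with the value `⊤` off its form domain. The value does not depend on the spectral decomposition
of `γ`, so that the infimum is over a single value. -/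
def traceForm (Q : H → EReal) (γ : H →L[ℂ] H) : EReal :=
  ⨅ (p : ℕ → ℝ) (ψ : ℕ → H) (_ : IsSpectralDecomposition γ p ψ),
    extIntegral Measure.count (fun k => (p k : EReal) * Q (ψ k))

end Operators

/-! ### State-valued probability measures -/

/-- A probability measure on `Z` with values in the positive trace class operators on `H`,
countably additive in trace norm. -/
structure StateValuedMeasure (Z : Type*) [MeasurableSpace Z]
    (H : Type*) [NormedAddCommGroup H] [InnerProductSpace ℂ H] [CompleteSpace H] where
  /-- The value of the measure on a (measurable) set. -/
  toFun : Set Z → (H →L[ℂ] H)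
  isPositive : ∀ S, MeasurableSet S → (toFun S).IsPositive
  traceClass : ∀ S, MeasurableSet S → traceNorm (toFun S) < ⊤
  empty : toFun ∅ = 0
  iUnion : ∀ S : ℕ → Set Z, (∀ n, MeasurableSet (S n)) → Pairwise (Function.onFun Disjoint S) →
    Tendsto (fun n => traceNorm (toFun (⋃ i, S i) - ∑ i ∈ Finset.range n, toFun (S i)))
      atTop (𝓝 0)
  norm_univ : traceNorm (toFun Set.univ) = 1

section Functionals

variable {Z : Type*} [MeasurableSpace Z]
variable {H : Type*} [NormedAddCommGroup H] [InnerProductSpace ℂ H] [CompleteSpace H]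

/-- `μ` is the norm measure of `𝔪` and `γ`, with values in the normalized density matrices, is the
Radon–Nikodym derivative of `𝔪` with respect to `μ`: `d𝔪(z) = γ(z) dμ(z)`. -/
structure IsRadonNikodym (𝔪 : StateValuedMeasure Z H) (μ : Measure Z) (γ : Z → (H →L[ℂ] H)) :
    Prop where
  norm_measure : ∀ S, MeasurableSet S → μ S = traceNorm (𝔪.toFun S)
  measurable : ∀ φ χ : H, Measurable fun z => ⟪φ, γ z χ⟫_ℂ
  density : ∀ᵐ z ∂μ, IsDensityMatrix (γ z)
  integral_eq : ∀ S, MeasurableSet S → ∀ φ χ : H,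
    ⟪φ, 𝔪.toFun S χ⟫_ℂ = ∫ z in S, ⟪φ, γ z χ⟫_ℂ ∂μ

/-- A scalar measure supported on finitely many points. (An infimum over these that agrees with the
one over all measures also agrees with the one over countably supported measures.) -/
def IsAtomic (μ : Measure Z) : Prop := ∃ F : Finset Z, μ (F : Set Z)ᶜ = 0

/-- A state-valued measure supported on finitely many points. -/
def StateValuedMeasure.IsAtomic (𝔪 : StateValuedMeasure Z H) : Prop :=
  ∃ F : Finset Z, 𝔪.toFun (F : Set Z)ᶜ = 0

/-! ### The variational problems

`𝓔 ψ z` is an energy functional of a wave function `ψ` and a classical field `z`, the value of the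
quadratic form of the quasi-classical Hamiltonian at `z` on `ψ`, equal to `⊤` off the form domain. -/

/-- `E_qc`. -/
def qcEnergy (𝓔 : H → Z → EReal) : EReal :=
  ⨅ (ψ : H) (z : Z) (_ : ‖ψ‖ = 1) (_ : IsFinite (𝓔 ψ z)), 𝓔 ψ z

/-- `𝓔_svm[𝔪] = ∫ dμ_𝔪(z) tr[γ_𝔪(z) 𝓗_z]`. The pair `(μ_𝔪, γ_𝔪)` is unique up to null sets, so
that the infimum is over a single value. -/
def svmFunctional (𝓔 : H → Z → EReal) (𝔪 : StateValuedMeasure Z H) : EReal :=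
  ⨅ (μ : Measure Z) (γ : Z → (H →L[ℂ] H)) (_ : IsRadonNikodym 𝔪 μ γ),
    extIntegral μ (fun z => traceForm (fun ψ => 𝓔 ψ z) (γ z))

/-- `E_svm`. -/
def svmEnergy (𝓔 : H → Z → EReal) : EReal :=
  ⨅ (𝔪 : StateValuedMeasure Z H) (_ : IsFinite (svmFunctional 𝓔 𝔪)), svmFunctional 𝓔 𝔪

/-- The infimum of `𝓔_svm` over atomic state-valued measures. -/
def svmAtomicEnergy (𝓔 : H → Z → EReal) : EReal :=
  ⨅ (𝔪 : StateValuedMeasure Z H) (_ : 𝔪.IsAtomic) (_ : IsFinite (svmFunctional 𝓔 𝔪)),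
    svmFunctional 𝓔 𝔪

/-- `𝓔_pm[ψ, μ] = ∫ dμ(z) ⟨ψ|𝓗_z|ψ⟩`. -/
def pmFunctional (𝓔 : H → Z → EReal) (ψ : H) (μ : Measure Z) : EReal :=
  extIntegral μ (fun z => 𝓔 ψ z)

/-- `E_pm`. -/
def pmEnergy (𝓔 : H → Z → EReal) : EReal :=
  ⨅ (ψ : H) (μ : Measure Z) (_ : ‖ψ‖ = 1) (_ : IsProbabilityMeasure μ)
    (_ : IsFinite (pmFunctional 𝓔 ψ μ)), pmFunctional 𝓔 ψ μ

/-- The infimum of `𝓔_pm` over atomic measures. -/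
def pmAtomicEnergy (𝓔 : H → Z → EReal) : EReal :=
  ⨅ (ψ : H) (μ : Measure Z) (_ : ‖ψ‖ = 1) (_ : IsProbabilityMeasure μ) (_ : IsAtomic μ)
    (_ : IsFinite (pmFunctional 𝓔 ψ μ)), pmFunctional 𝓔 ψ μ

/-- `E_F`, the infimum of a functional `F[ψ]` over normalized `ψ` of finite energy. -/
def waveEnergy (F : H → EReal) : EReal :=
  ⨅ (ψ : H) (_ : ‖ψ‖ = 1) (_ : IsFinite (F ψ)), F ψ

/-- The Pekar functional `𝓔_Pekar[ψ] = inf_z 𝓔[ψ, z]`. -/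
def pekarFunctional (𝓔 : H → Z → EReal) (ψ : H) : EReal := ⨅ z : Z, 𝓔 ψ z

/-- `z` solves the Euler–Lagrange equation `δ_z 𝓔[ψ, z] = 0` at fixed `ψ`. -/
def IsCriticalField [AddCommGroup Z] [Module ℂ Z] (𝓔 : H → Z → EReal) (ψ : H) (z : Z) : Prop :=
  ∀ ζ : Z, HasDerivAt (fun t : ℝ => (𝓔 ψ (z + (t : ℂ) • ζ)).toReal) 0 0

/-- The Pekar functional in its implicit form: `𝓔_Pekar[ψ] = 𝓔[ψ, z_ψ]`, where `z_ψ` is the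
solution of `δ_z 𝓔[ψ, z] = 0` (and `⊤` if there is none). -/
def pekarImplicitFunctional [AddCommGroup Z] [Module ℂ Z] (𝓔 : H → Z → EReal) (ψ : H) : EReal :=
  ⨅ (z : Z) (_ : IsCriticalField 𝓔 ψ z), 𝓔 ψ z

/-- `𝓘[z] = inf_ψ 𝓔[ψ, z]` over normalized `ψ`. -/
def fieldFunctional (𝓔 : H → Z → EReal) (z : Z) : EReal := ⨅ (ψ : H) (_ : ‖ψ‖ = 1), 𝓔 ψ z

/-- All the ground state energies attached to `𝓔` coincide, as extended real numbers. -/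
def EnergiesCoincide [AddCommGroup Z] [Module ℂ Z] (𝓔 : H → Z → EReal) : Prop :=
  qcEnergy 𝓔 = svmEnergy 𝓔 ∧
  svmEnergy 𝓔 = svmAtomicEnergy 𝓔 ∧
  svmAtomicEnergy 𝓔 = pmEnergy 𝓔 ∧
  pmEnergy 𝓔 = pmAtomicEnergy 𝓔 ∧
  pmAtomicEnergy 𝓔 = waveEnergy (pekarFunctional 𝓔) ∧
  waveEnergy (pekarFunctional 𝓔) = waveEnergy (pekarImplicitFunctional 𝓔) ∧
  waveEnergy (pekarImplicitFunctional 𝓔) = ⨅ z : Z, fieldFunctional 𝓔 z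

end Functionals

/-! ### The particles -/

/-- `ℝ^d`. -/
abbrev Space (d : ℕ) := EuclideanSpace ℝ (Fin d)

/-- `ℝ^{dN}`, the configuration space of `N` particles in `ℝ^d`. -/
abbrev Config (d N : ℕ) := EuclideanSpace ℝ (Fin N × Fin d)

/-- `L²(ℝ^{dN})`. -/
abbrev ParticleSpace (d N : ℕ) := Lp ℂ 2 (volume : Measure (Config d N))

/-- The position `x_j ∈ ℝ^d` of the `j`-th particle in the configuration `X = (x_1, …, x_N)`. -/
def position {d N : ℕ} (j : Fin N) (X : Config d N) : Space d :=
  WithLp.toLp 2 fun l => X (j, l)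

/-- `G` is the weak gradient of `ψ`, with components in `L²`. -/
def IsWeakGradient {d N : ℕ} (ψ : ParticleSpace d N) (G : Fin N × Fin d → ParticleSpace d N) :
    Prop :=
  ∀ (a : Fin N × Fin d) (φ : Config d N → ℝ), ContDiff ℝ ((⊤ : ℕ∞) : WithTop ℕ∞) φ →
    HasCompactSupport φ →
    ∫ X, ψ X * (fderiv ℝ φ X (EuclideanSpace.single a 1) : ℂ) = - ∫ X, G a X * (φ X : ℂ)

/-- `ψ ∈ H¹(ℝ^{dN})`. -/
def MemH1 {d N : ℕ} (ψ : ParticleSpace d N) : Prop := ∃ G, IsWeakGradient ψ G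

open Classical in
/-- The weak gradient of `ψ ∈ H¹(ℝ^{dN})`. -/
def weakGrad {d N : ℕ} (ψ : ParticleSpace d N) : Fin N × Fin d → ParticleSpace d N :=
  if h : MemH1 ψ then h.choose else 0

/-- A nonnegative locally integrable potential `𝓦` on `ℝ^{dN}`. -/
structure Potential (d N : ℕ) where
  /-- The potential. -/
  W : Config d N → ℝ
  locallyIntegrable : LocallyIntegrable W volume
  nonneg : ∀ᵐ X, 0 ≤ W X

/-- The form domain of `-Δ + 𝓦`. -/
def Potential.FormDomain {d N : ℕ} (V : Potential d N) (ψ : ParticleSpace d N) : Prop :=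
  MemH1 ψ ∧ Integrable (fun X => V.W X * ‖ψ X‖ ^ 2)

/-- `⟨ψ|𝓦|ψ⟩`. -/
def Potential.energy {d N : ℕ} (V : Potential d N) (ψ : ParticleSpace d N) : ℝ :=
  ∫ X, V.W X * ‖ψ X‖ ^ 2

/-! ### The classical field -/

section Field

variable {𝔥 : Type*} [NormedAddCommGroup 𝔥] [InnerProductSpace ℂ 𝔥] [CompleteSpace 𝔥]

/-- A nonnegative self-adjoint, possibly unbounded, injective operator `ω` on `𝔥`. -/
structure Dispersion (𝔥 : Type*) [NormedAddCommGroup 𝔥] [InnerProductSpace ℂ 𝔥]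
    [CompleteSpace 𝔥] where
  /-- The operator. -/
  op : 𝔥 →ₗ.[ℂ] 𝔥
  selfAdjoint : IsSelfAdjoint op
  nonneg : ∀ u : op.domain, 0 ≤ (⟪(u : 𝔥), op u⟫_ℂ).re
  injective : ∀ u : op.domain, op u = 0 → (u : 𝔥) = 0

/-- `S` is the nonnegative self-adjoint square root `ω^{1/2}` of `ω`. -/
structure IsSqrt (S : 𝔥 →ₗ.[ℂ] 𝔥) (ω : Dispersion 𝔥) : Prop where
  selfAdjoint : IsSelfAdjoint S
  nonneg : ∀ u : S.domain, 0 ≤ (⟪(u : 𝔥), S u⟫_ℂ).re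
  sq : ∀ u w : 𝔥, (u, w) ∈ ω.op.graph ↔ ∃ v, (u, v) ∈ S.graph ∧ (v, w) ∈ S.graph

/-- `ω^{1/2} f ∈ L^∞(ℝ^d; 𝔥)`. -/
def SqrtBounded {d : ℕ} (ω : Dispersion 𝔥) (f : Space d → 𝔥) : Prop :=
  ∃ (S : 𝔥 →ₗ.[ℂ] 𝔥) (g : Space d → 𝔥), IsSqrt S ω ∧ MemLp g ⊤ volume ∧
    ∀ᵐ x, (f x, g x) ∈ S.graph

/-- `ω^{-1/2} f ∈ L^∞(ℝ^d; 𝔥)`. -/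
def InvSqrtBounded {d : ℕ} (ω : Dispersion 𝔥) (f : Space d → 𝔥) : Prop :=
  ∃ (S : 𝔥 →ₗ.[ℂ] 𝔥) (g : Space d → 𝔥), IsSqrt S ω ∧ MemLp g ⊤ volume ∧
    ∀ᵐ x, (g x, f x) ∈ S.graph

/-- The domain of `ω^k`. -/
def Dispersion.powDomain (ω : Dispersion 𝔥) : ℕ → Submodule ℂ 𝔥
  | 0 => ⊤
  | k + 1 => ((ω.powDomain k).comap ω.op.toFun).map ω.op.domain.subtype

theorem Dispersion.mem_domain (ω : Dispersion 𝔥) {u : 𝔥} (hu : u ∈ ⨅ k, ω.powDomain k) :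
    u ∈ ω.op.domain := by
  have h := (Submodule.mem_iInf _).1 hu 1
  obtain ⟨v, -, rfl⟩ := h
  exact v.2

/-- The space `⋂ₖ 𝓓(ω^k)`, to be endowed with the scalar product `⟨u|ω|v⟩`. -/
def Dispersion.Smooth (ω : Dispersion 𝔥) : Type _ := ↥(⨅ k, ω.powDomain k)

instance (ω : Dispersion 𝔥) : AddCommGroup ω.Smooth :=
  inferInstanceAs (AddCommGroup ↥(⨅ k, ω.powDomain k))

instance (ω : Dispersion 𝔥) : Module ℂ ω.Smooth :=
  inferInstanceAs (Module ℂ ↥(⨅ k, ω.powDomain k))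

/-- The inclusion of `⋂ₖ 𝓓(ω^k)` into `𝓓(ω)`. -/
def Dispersion.toDomain (ω : Dispersion 𝔥) : ω.Smooth →ₗ[ℂ] ω.op.domain :=
  Submodule.inclusion (p := ⨅ k, ω.powDomain k) fun _ hu => ω.mem_domain hu

theorem Dispersion.symmetric (ω : Dispersion 𝔥) (u v : ω.op.domain) :
    ⟪ω.op u, (v : 𝔥)⟫_ℂ = ⟪(u : 𝔥), ω.op v⟫_ℂ := by
  have h := LinearPMap.adjoint_isFormalAdjoint (T := ω.op) ω.selfAdjoint.dense_domain
  rw [LinearPMap.isSelfAdjoint_def.1 ω.selfAdjoint] at h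
  exact h u v

/-- The scalar product `⟨u|ω|v⟩` on `⋂ₖ 𝓓(ω^k)`. -/
@[reducible]
def Dispersion.core (ω : Dispersion 𝔥) : PreInnerProductSpace.Core ℂ ω.Smooth where
  inner u v := ⟪(ω.toDomain u : 𝔥), ω.op (ω.toDomain v)⟫_ℂ
  conj_inner_symm u v := by
    rw [inner_conj_symm, ω.symmetric]
  re_inner_nonneg u := ω.nonneg _
  add_left u v w := by simp
  smul_left u v r := by simp [mul_comm]

instance (ω : Dispersion 𝔥) : SeminormedAddCommGroup ω.Smooth :=
  @InnerProductSpace.Core.toSeminormedAddCommGroup ℂ ω.Smooth _ _ _ ω.core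

instance (ω : Dispersion 𝔥) : InnerProductSpace ℂ ω.Smooth := InnerProductSpace.ofCore ω.core

/-- The Hilbert space `𝔥_ω`, the completion of `⋂ₖ 𝓓(ω^k)` for `⟨·|ω|·⟩`. -/
abbrev Dispersion.FieldSpace (ω : Dispersion 𝔥) : Type _ := UniformSpace.Completion ω.Smooth

instance (ω : Dispersion 𝔥) : MeasurableSpace ω.FieldSpace := borel _

instance (ω : Dispersion 𝔥) : BorelSpace ω.FieldSpace := ⟨rfl⟩

/-- `⟨z|f⟩` for `z ∈ 𝔥_ω` and `f ∈ 𝓓(ω^{-1/2})`: the extension by continuity of the scalar product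
of `𝔥` from `⋂ₖ 𝓓(ω^k)` to `𝔥_ω`. -/
def Dispersion.pairing (ω : Dispersion 𝔥) (z : ω.FieldSpace) (f : 𝔥) : ℂ :=
  UniformSpace.Completion.extension (fun u : ω.Smooth => ⟪(ω.toDomain u : 𝔥), f⟫_ℂ) z

end Field

/-! ### The Nelson model -/

/-- The data of the Nelson model. -/
structure NelsonModel (𝔥 : Type*) [NormedAddCommGroup 𝔥] [InnerProductSpace ℂ 𝔥]
    [CompleteSpace 𝔥] (d N : ℕ) where
  /-- The external potential and the interaction of the particles. -/
  potential : Potential d N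
  /-- The dispersion relation of the field. -/
  ω : Dispersion 𝔥
  /-- The form factor `x ↦ λ(x)`. -/
  lam : Space d → 𝔥
  memLp : MemLp lam ⊤ volume
  invSqrt : InvSqrtBounded ω lam

open Classical in
/-- `𝓔_qc[ψ, z] = ⟨ψ| ∑ⱼ (-Δⱼ + 2 Re ⟨z|λ(xⱼ)⟩) + 𝓦 + ⟨z|ω|z⟩ |ψ⟩`. -/
def NelsonModel.energy {𝔥 : Type*} [NormedAddCommGroup 𝔥] [InnerProductSpace ℂ 𝔥]
    [CompleteSpace 𝔥] {d N : ℕ} (M : NelsonModel 𝔥 d N)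
    (ψ : ParticleSpace d N) (z : M.ω.FieldSpace) : EReal :=
  if M.potential.FormDomain ψ then
    (((∑ a, ‖weakGrad ψ a‖ ^ 2) + M.potential.energy ψ
      + (∑ j, ∫ X, 2 * (M.ω.pairing z (M.lam (position j X))).re * ‖ψ X‖ ^ 2)
      + ‖z‖ ^ 2 * ‖ψ‖ ^ 2 : ℝ) : EReal)
  else ⊤

/-! ### The polaron model -/

/-- The field space `L²(ℝ^d)` of the polaron (where `ω = 1`). -/
abbrev PolaronField (d : ℕ) := Lp ℂ 2 (volume : Measure (Space d))

instance (d : ℕ) : MeasurableSpace (PolaronField d) := borel _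

instance (d : ℕ) : BorelSpace (PolaronField d) := ⟨rfl⟩

/-- The data of the polaron model: the potential, the coupling constant `α`, and the cut-off `ϱ`
used to give a meaning to the singular potential `𝓥_z`. -/
structure PolaronModel (d N : ℕ) where
  /-- The external potential and the interaction of the particles. -/
  potential : Potential d N
  /-- The coupling constant. -/
  α : ℝ
  α_pos : 0 < α
  /-- The momentum cut-off. -/
  ϱ : ℝ
  ϱ_pos : 0 < ϱ

namespace PolaronModel

variable {d N : ℕ} (M : PolaronModel d N)

/-- The low momentum part
`𝓥_{<,z}(x) = 2 Re ∫_{|k| ≤ ϱ} conj z(k) √α |k|^{-(d-1)/2} e^{-ik·x} dk` of the potential. -/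
def lowPotential (z : PolaronField d) (x : Space d) : ℝ :=
  2 * (∫ k in {k : Space d | ‖k‖ ≤ M.ϱ}, (starRingEnd ℂ) (z k) *
    ((Real.sqrt M.α * ‖k‖ ^ (-((d : ℝ) - 1) / 2) : ℝ) : ℂ) *
      Complex.exp (-(Complex.I * (⟪k, x⟫_ℝ : ℂ)))).re

/-- The components of the bounded vector field
`𝐛_z(x) = -2 Im ∫_{|k| > ϱ} conj z(k) √α |k|^{-(d+1)/2} (k/|k|) e^{-ik·x} dk`, whose divergence
is the high momentum part `2 Re ∫_{|k| > ϱ} conj z(k) √α |k|^{-(d-1)/2} e^{-ik·x} dk` of the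
potential. -/
def highField (z : PolaronField d) (l : Fin d) (x : Space d) : ℝ :=
  -2 * (∫ k in {k : Space d | M.ϱ < ‖k‖}, (starRingEnd ℂ) (z k) *
    ((Real.sqrt M.α * ‖k‖ ^ (-((d : ℝ) + 1) / 2) * (k l / ‖k‖) : ℝ) : ℂ) *
      Complex.exp (-(Complex.I * (⟪k, x⟫_ℝ : ℂ)))).im

open Classical in
/-- `𝓔_qc[ψ, z] = ⟨ψ| ∑ⱼ (-Δⱼ + 𝓥_z(xⱼ)) + 𝓦 + ‖z‖² |ψ⟩` with `𝓥_z = 𝓥_{<,z} + div 𝐛_z`, where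
`⟨ψ|(div 𝐛_z)(xⱼ)|ψ⟩ = -2 Re ∫ 𝐛_z(xⱼ) · conj ψ ∇ⱼψ`. -/
def energy (ψ : ParticleSpace d N) (z : PolaronField d) : EReal :=
  if M.potential.FormDomain ψ then
    (((∑ a, ‖weakGrad ψ a‖ ^ 2) + M.potential.energy ψ
      + (∑ j, ((∫ X, M.lowPotential z (position j X) * ‖ψ X‖ ^ 2)
        - 2 * ∑ l, ∫ X, M.highField z l (position j X) *
            ((starRingEnd ℂ) (ψ X) * weakGrad ψ (j, l) X).re))
      + ‖z‖ ^ 2 * ‖ψ‖ ^ 2 : ℝ) : EReal)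
  else ⊤

end PolaronModel

/-! ### The Pauli–Fierz model -/

/-- The data of the Pauli–Fierz model (in three dimensions). -/
structure PauliFierzModel (𝔥 : Type*) [NormedAddCommGroup 𝔥] [InnerProductSpace ℂ 𝔥]
    [CompleteSpace 𝔥] (N : ℕ) where
  /-- The external potential and the interaction of the particles. -/
  potential : Potential 3 N
  /-- The dispersion relation of the field. -/
  ω : Dispersion 𝔥
  /-- The masses of the particles. -/
  mass : Fin N → ℝ
  mass_pos : ∀ j, 0 < mass j
  /-- The charge. -/
  e : ℝ
  /-- The form factors `x ↦ λ_{j,l}(x)`. -/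
  lam : Fin N → Fin 3 → Space 3 → 𝔥
  memLp : ∀ j l, MemLp (lam j l) ⊤ volume
  sqrt : ∀ j l, SqrtBounded ω (lam j l)
  invSqrt : ∀ j l, InvSqrtBounded ω (lam j l)
  /-- Coulomb gauge, `∇ · 𝛌_j = 0` in the sense of distributions. -/
  coulomb : ∀ (j : Fin N) (φ : Space 3 → ℝ), ContDiff ℝ ((⊤ : ℕ∞) : WithTop ℕ∞) φ →
    HasCompactSupport φ →
    ∑ l, ∫ x, ((fderiv ℝ φ x (EuclideanSpace.single l 1) : ℝ) : ℂ) • lam j l x = 0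

namespace PauliFierzModel

variable {𝔥 : Type*} [NormedAddCommGroup 𝔥] [InnerProductSpace ℂ 𝔥] [CompleteSpace 𝔥] {N : ℕ}
  (M : PauliFierzModel 𝔥 N)

/-- The components of the classical field `𝐚_{z,j}(x) = 2 Re ⟨z|𝛌_j(x)⟩`. -/
def vectorPotential (z : M.ω.FieldSpace) (j : Fin N) (l : Fin 3) (x : Space 3) : ℝ :=
  2 * (M.ω.pairing z (M.lam j l x)).re

open Classical in
/-- `𝓔_qc[ψ, z] = ⟨ψ| ∑ⱼ (2mⱼ)⁻¹ (-i∇ⱼ + e 𝐚_{z,j}(xⱼ))² + 𝓦 + ⟨z|ω|z⟩ |ψ⟩`. -/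
def energy (ψ : ParticleSpace 3 N) (z : M.ω.FieldSpace) : EReal :=
  if M.potential.FormDomain ψ then
    (((∑ j, (1 / (2 * M.mass j)) * ∑ l, ∫ X, ‖-Complex.I * weakGrad ψ (j, l) X
          + ((M.e * M.vectorPotential z j l (position j X) : ℝ) : ℂ) * ψ X‖ ^ 2)
      + M.potential.energy ψ + ‖z‖ ^ 2 * ‖ψ‖ ^ 2 : ℝ) : EReal)
  else ⊤

end PauliFierzModel

end QuasiClassical

end

/-! Every energy is compared with `qcEnergy`. The functionals over measures are averages of values
`𝓔 ψ z` at unit vectors `ψ`: against a probability measure in `z` and, for state-valued measures,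
also against the eigenvalues of a density matrix, which sum to one. An average is never below the
infimum, even if that is infinite. Conversely, the point mass at `z`, carrying the pure state of
`ψ`, is an atomic competitor with value exactly `𝓔 ψ z`. Hence averaging neither lowers nor raises
the infimum.

Two points need more than this: the restriction to finite energies, and the Pekar functionals. Both
are settled by the property `IsQuadraticInField`, common to the three models: at fixed unit `ψ` the
energy is either `⊤` for all `z` or a real polynomial of degree two in `z` whose quadratic part is
at least `‖z‖ ^ 2`. Such a polynomial has a critical point by Lax–Milgram, and a critical point is a
minimizer by convexity (`exists_isCriticalField_and_le`). So the infimum over `z` is attained, is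
finite, and agrees with the implicit Pekar functional. The abstract conclusion is
`IsQuadraticInField.energiesCoincide`.

For the models, the coupling must be a bounded real-linear map from fields to bounded functions
(`IsBddField`). For Nelson and Pauli–Fierz this is duality between `ω^{1/2}` and `ω^{-1/2}`; for the
polaron it is Cauchy–Schwarz, as the two kernels are square integrable below and above the cut-off.
-/

noncomputable section

namespace QuasiClassical

open MeasureTheory Filter Topology
open scoped ENNReal InnerProductSpace

/-! ### Extended real integrals -/

section ExtIntegral

variable {Z : Type*} [MeasurableSpace Z]

theorem toENNReal_sub_toENNReal_neg (x : EReal) :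
    ((x.toENNReal : ℝ≥0∞) : EReal) - (((-x).toENNReal : ℝ≥0∞) : EReal) = x := by
  rcases le_total 0 x with h | h
  · rw [EReal.coe_toENNReal h, EReal.toENNReal_of_nonpos (by simpa using h)]
    simp
  · rw [EReal.toENNReal_of_nonpos h, EReal.coe_toENNReal (by simpa using h)]
    simp

/-- Both lower Lebesgue integrals are monotone without measurability, and subtraction in `EReal` is
monotone even where it meets `⊤ - ⊤`. So averages can be bounded below with no integrability check.
-/
theorem extIntegral_mono {μ : Measure Z} {f g : Z → EReal} (h : ∀ᵐ z ∂μ, f z ≤ g z) :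
    extIntegral μ f ≤ extIntegral μ g := by
  refine EReal.sub_le_sub ?_ ?_
  · exact EReal.coe_ennreal_le_coe_ennreal_iff.2 <|
      lintegral_mono_ae (h.mono fun z hz => EReal.toENNReal_le_toENNReal hz)
  · exact EReal.coe_ennreal_le_coe_ennreal_iff.2 <|
      lintegral_mono_ae (h.mono fun z hz => EReal.toENNReal_le_toENNReal (EReal.neg_le_neg_iff.2 hz))

theorem extIntegral_const (μ : Measure Z) [IsProbabilityMeasure μ] (c : EReal) :
    extIntegral μ (fun _ => c) = c := by
  simp [extIntegral, toENNReal_sub_toENNReal_neg]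

theorem extIntegral_dirac [MeasurableSingletonClass Z] (z : Z) (f : Z → EReal) :
    extIntegral (Measure.dirac z) f = f z := by
  simp [extIntegral, toENNReal_sub_toENNReal_neg]

theorem extIntegral_count_weights {p : ℕ → ℝ} (hp : ∀ k, 0 ≤ p k)
    (hsum : ∑' k, ENNReal.ofReal (p k) = 1) (c : EReal) :
    extIntegral Measure.count (fun k => (p k : EReal) * c) = c := by
  have h (c : EReal) : ∫⁻ k, ((p k : EReal) * c).toENNReal ∂Measure.count = c.toENNReal := by
    simp_rw [lintegral_count, EReal.toENNReal_mul (EReal.coe_nonneg.2 (hp _)),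
      EReal.toENNReal_of_ne_top (EReal.coe_ne_top _), EReal.toReal_coe]
    rw [ENNReal.tsum_mul_right, hsum, one_mul]
  simp only [extIntegral, ← mul_neg, h, toENNReal_sub_toENNReal_neg]

end ExtIntegral

/-! ### Trace norm and traces of forms -/

section Trace

variable {H : Type*} [NormedAddCommGroup H] [InnerProductSpace ℂ H]

theorem traceNorm_zero : traceNorm (0 : H →L[ℂ] H) = 0 := by
  simp [traceNorm]

/-- Bessel's inequality for both families, after the arithmetic-geometric mean inequality. It says
that a rank one projection contributes at most one to the trace norm. -/
theorem norm_sum_inner_mul_inner_le_one {n : ℕ} {u v : Fin n → H} (hu : Orthonormal ℂ u)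
    (hv : Orthonormal ℂ v) {x : H} (hx : ‖x‖ = 1) :
    ‖∑ i, ⟪u i, x⟫_ℂ * ⟪x, v i⟫_ℂ‖ ≤ 1 := by
  have h1 := hu.sum_inner_products_le x (s := Finset.univ)
  have h2 := hv.sum_inner_products_le x (s := Finset.univ)
  rw [hx] at h1 h2
  calc ‖∑ i, ⟪u i, x⟫_ℂ * ⟪x, v i⟫_ℂ‖ ≤ ∑ i, ‖⟪u i, x⟫_ℂ * ⟪x, v i⟫_ℂ‖ := norm_sum_le _ _
    _ ≤ ∑ i, (‖⟪u i, x⟫_ℂ‖ ^ 2 + ‖⟪v i, x⟫_ℂ‖ ^ 2) / 2 := by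
        refine Finset.sum_le_sum fun i _ => ?_
        rw [norm_mul, norm_inner_symm x (v i)]
        nlinarith [sq_nonneg (‖⟪u i, x⟫_ℂ‖ - ‖⟪v i, x⟫_ℂ‖)]
    _ = (∑ i, ‖⟪u i, x⟫_ℂ‖ ^ 2 + ∑ i, ‖⟪v i, x⟫_ℂ‖ ^ 2) / 2 := by
        rw [← Finset.sum_div, Finset.sum_add_distrib]
    _ ≤ 1 := by linarith

theorem IsSpectralDecomposition.apply_eq {γ : H →L[ℂ] H} {p : ℕ → ℝ} {ψ : ℕ → H}
    (h : IsSpectralDecomposition γ p ψ) (k : ℕ) : γ (ψ k) = (p k : ℂ) • ψ k := by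
  have h1 := h.hasSum (ψ k)
  have h2 := hasSum_single (f := fun j => ((p j : ℂ) * ⟪ψ j, ψ k⟫_ℂ) • ψ j) k fun j hj => by
    simp [h.orthonormal.2 hj]
  rw [h1.unique h2]
  simp [inner_self_eq_norm_sq_to_K, h.orthonormal.1 k]

/-- The upper bound sums the rank one bound with weights `p k`; testing on the first `n`
eigenvectors gives the partial sums. For a density matrix, the eigenvalues thus form a probability
distribution. -/
theorem IsSpectralDecomposition.traceNorm_eq {γ : H →L[ℂ] H} {p : ℕ → ℝ} {ψ : ℕ → H}
    (h : IsSpectralDecomposition γ p ψ) : traceNorm γ = ∑' k, ENNReal.ofReal (p k) := by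
  apply le_antisymm
  · refine iSup_le fun n => iSup_le fun u => iSup_le fun v => iSup_le fun hu => iSup_le fun hv => ?_
    have hs : HasSum (fun k => (p k : ℂ) * ∑ i, ⟪u i, ψ k⟫_ℂ * ⟪ψ k, v i⟫_ℂ)
        (∑ i, ⟪u i, γ (v i)⟫_ℂ) := by
      simp_rw [Finset.mul_sum]
      refine hasSum_sum fun i _ => ?_
      have := (h.hasSum (v i)).mapL (innerSL ℂ (u i))
      simp only [innerSL_apply_apply, inner_smul_right] at this
      refine this.congr_fun fun k => ?_
      ring
    rw [← hs.tsum_eq]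
    refine enorm_tsum_le_tsum_enorm.trans (ENNReal.tsum_le_tsum fun k => ?_)
    rw [← ofReal_norm]
    apply ENNReal.ofReal_le_ofReal
    rw [norm_mul, Complex.norm_real, Real.norm_of_nonneg (h.nonneg k)]
    exact mul_le_of_le_one_right (h.nonneg k)
      (norm_sum_inner_mul_inner_le_one hu hv (h.orthonormal.1 k))
  · rw [ENNReal.tsum_eq_iSup_nat]
    refine iSup_le fun n => ?_
    have ho : Orthonormal ℂ (fun i : Fin n => ψ i) := h.orthonormal.comp _ Fin.val_injective
    refine le_iSup_of_le n <| le_iSup_of_le (fun i => ψ i) <| le_iSup_of_le (fun i => ψ i) <|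
      le_iSup_of_le ho <| le_iSup_of_le ho ?_
    have (i : Fin n) : ⟪ψ i, γ (ψ i)⟫_ℂ = ((p i : ℝ) : ℂ) := by
      rw [h.apply_eq, inner_smul_right, inner_self_eq_norm_sq_to_K, h.orthonormal.1]
      simp
    simp_rw [this, ← Complex.ofReal_sum]
    rw [← ofReal_norm, Complex.norm_real,
      Real.norm_of_nonneg (Finset.sum_nonneg fun (i : Fin n) _ => h.nonneg i),
      ENNReal.ofReal_sum_of_nonneg (fun (i : Fin n) _ => h.nonneg i),
      Finset.sum_range fun k => ENNReal.ofReal (p k)]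

/-- The pure state `|ψ⟩⟨ψ|`. -/
def pureState (ψ : H) : H →L[ℂ] H := InnerProductSpace.rankOne ℂ ψ ψ

theorem pureState_apply (ψ φ : H) : pureState ψ φ = ⟪ψ, φ⟫_ℂ • ψ := rfl

theorem isPositive_pureState (ψ : H) : (pureState ψ).IsPositive :=
  InnerProductSpace.isPositive_rankOne_self ψ

variable [CompleteSpace H]

/-- Averaging with weights of total mass one. Eigenvectors of weight zero need no bound, since `0 *
⊤ = 0` in `EReal`. -/
theorem le_traceForm {Q : H → EReal} {γ : H →L[ℂ] H} (hγ : IsDensityMatrix γ) {c : EReal}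
    (hc : ∀ p ψ, IsSpectralDecomposition γ p ψ → ∀ k, p k ≠ 0 → c ≤ Q (ψ k)) :
    c ≤ traceForm Q γ := by
  refine le_iInf fun p => le_iInf fun ψ => le_iInf fun h => ?_
  rw [← extIntegral_count_weights h.nonneg (h.traceNorm_eq.symm.trans hγ.2) c]
  refine extIntegral_mono (ae_of_all _ fun k => ?_)
  rcases eq_or_ne (p k) 0 with h0 | h0
  · simp [h0]
  · exact mul_le_mul_of_nonneg_left (hc p ψ h k h0) (EReal.coe_nonneg.2 (h.nonneg k))

theorem traceForm_le {Q : H → EReal} {γ : H →L[ℂ] H} (hγ : IsDensityMatrix γ) {c : EReal}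
    {p : ℕ → ℝ} {ψ : ℕ → H} (h : IsSpectralDecomposition γ p ψ)
    (hc : ∀ k, p k ≠ 0 → Q (ψ k) ≤ c) : traceForm Q γ ≤ c := by
  refine iInf_le_of_le p <| iInf_le_of_le ψ <| iInf_le_of_le h ?_
  conv_rhs => rw [← extIntegral_count_weights h.nonneg (h.traceNorm_eq.symm.trans hγ.2) c]
  refine extIntegral_mono (ae_of_all _ fun k => ?_)
  rcases eq_or_ne (p k) 0 with h0 | h0
  · simp [h0]
  · exact mul_le_mul_of_nonneg_left (hc k h0) (EReal.coe_nonneg.2 (h.nonneg k))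

/-- In an infinite dimensional Hilbert space, a unit vector is the first term of an orthonormal
sequence. -/
theorem exists_orthonormal_seq (hH : ¬ FiniteDimensional ℂ H) {ψ : H} (hψ : ‖ψ‖ = 1) :
    ∃ e : ℕ → H, Orthonormal ℂ e ∧ e 0 = ψ := by
  have hs : Orthonormal ℂ ((↑) : ({ψ} : Set H) → H) := by
    constructor
    · rintro ⟨x, rfl⟩
      exact hψ
    · rintro ⟨x, rfl⟩ ⟨y, rfl⟩ h
      exact absurd rfl h
  obtain ⟨w, b, hw, hb⟩ := hs.exists_hilbertBasis_extension
  have hinf : Infinite w := by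
    rw [← not_finite_iff_infinite]
    intro hfin
    have := Fintype.ofFinite w
    exact hH b.toOrthonormalBasis.toBasis.finiteDimensional_of_finite
  classical
  let x : w := ⟨ψ, hw rfl⟩
  let f : ℕ ↪ w := Infinite.natEmbedding w
  have hon : Orthonormal ℂ ((↑) : w → H) := hb ▸ b.orthonormal
  -- The transposition moves `ψ` to index zero and keeps the enumeration injective.
  refine ⟨fun n => (Equiv.swap (f 0) x (f n) : H),
    hon.comp (fun n => Equiv.swap (f 0) x (f n)) ((Equiv.injective _).comp f.injective), ?_⟩
  simp [x]

/-- Infinite dimension enters here: `IsSpectralDecomposition` demands an orthonormal family indexed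
by all of `ℕ`, so the single eigenvector has to be padded by vectors of weight zero. -/
theorem exists_spectral_pureState (hH : ¬ FiniteDimensional ℂ H) {ψ : H} (hψ : ‖ψ‖ = 1) :
    ∃ e : ℕ → H, IsSpectralDecomposition (pureState ψ) (Pi.single 0 1) e ∧ e 0 = ψ := by
  obtain ⟨e, he, rfl⟩ := exists_orthonormal_seq hH hψ
  refine ⟨e, ⟨fun k => ?_, he, fun φ => ?_⟩, rfl⟩
  · rcases eq_or_ne k 0 with rfl | hk <;> simp [*]
  · convert hasSum_single (f := fun k =>
      (((Pi.single 0 1 : ℕ → ℝ) k : ℂ) * ⟪e k, φ⟫_ℂ) • e k) 0 (fun k hk => by simp [hk]) using 1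
    simp [pureState_apply]

theorem traceNorm_pureState (hH : ¬ FiniteDimensional ℂ H) {ψ : H} (hψ : ‖ψ‖ = 1) :
    traceNorm (pureState ψ) = 1 := by
  obtain ⟨e, he, -⟩ := exists_spectral_pureState hH hψ
  rw [he.traceNorm_eq, tsum_eq_single 0 (fun k hk => by simp [hk])]
  simp

theorem isDensityMatrix_pureState (hH : ¬ FiniteDimensional ℂ H) {ψ : H} (hψ : ‖ψ‖ = 1) :
    IsDensityMatrix (pureState ψ) :=
  ⟨isPositive_pureState ψ, traceNorm_pureState hH hψ⟩

/-- An eigenvector of nonzero eigenvalue lies in the range of the projection, so it is `ψ` up to a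
phase. Phase invariance of `Q` makes the value independent of the decomposition. -/
theorem traceForm_pureState (hH : ¬ FiniteDimensional ℂ H) {Q : H → EReal}
    (hQ : ∀ (c : ℂ) (φ : H), ‖c‖ = 1 → Q (c • φ) = Q φ) {ψ : H} (hψ : ‖ψ‖ = 1) :
    traceForm Q (pureState ψ) = Q ψ := by
  have hd := isDensityMatrix_pureState hH hψ
  apply le_antisymm
  · obtain ⟨e, he, he0⟩ := exists_spectral_pureState hH hψ
    refine traceForm_le hd he fun k hk => ?_
    obtain rfl : k = 0 := by
      by_contra h
      simp [h] at hk
    rw [he0]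
  · refine le_traceForm hd fun p e h k hk => ?_
    have h1 := h.apply_eq k
    rw [pureState_apply] at h1
    have hk' : (p k : ℂ) ≠ 0 := by exact_mod_cast hk
    have h2 : e k = ((p k : ℂ)⁻¹ * ⟪ψ, e k⟫_ℂ) • ψ := by
      rw [mul_smul, h1, smul_smul, inv_mul_cancel₀ hk', one_smul]
    have h3 : ‖(p k : ℂ)⁻¹ * ⟪ψ, e k⟫_ℂ‖ = 1 := by
      have := h.orthonormal.1 k
      rw [h2, norm_smul, hψ, mul_one] at this
      exact this
    rw [h2, hQ _ _ h3]

end Trace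

/-! ### Point masses carrying a pure state -/

section DiracState

variable {Z : Type*} [MeasurableSpace Z]
variable {H : Type*} [NormedAddCommGroup H] [InnerProductSpace ℂ H] [CompleteSpace H]

open Classical in
/-- The state-valued measure `|ψ⟩⟨ψ| δ_z`. -/
def diracState (hH : ¬ FiniteDimensional ℂ H) {ψ : H} (hψ : ‖ψ‖ = 1) (z : Z) :
    StateValuedMeasure Z H where
  toFun S := if z ∈ S then pureState ψ else 0
  isPositive S _ := by
    split_ifs
    · exact isPositive_pureState ψ
    · exact ContinuousLinearMap.isPositive_zero
  traceClass S _ := by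
    split_ifs
    · simp [traceNorm_pureState hH hψ]
    · simp [traceNorm_zero]
  empty := by simp
  iUnion S _ hd := by
    refine tendsto_const_nhds.congr' ?_
    by_cases hz : ∃ i, z ∈ S i
    · obtain ⟨i, hi⟩ := hz
      -- By disjointness only `S i` contains `z`, so the partial sums are exact once `i` is
      -- included.
      filter_upwards [eventually_gt_atTop i] with n hn
      have hj (j : ℕ) (hj : j ≠ i) : z ∉ S j := fun h => (hd hj).le_bot ⟨h, hi⟩
      rw [if_pos (Set.mem_iUnion.2 ⟨i, hi⟩), Finset.sum_eq_single i
        (fun j _ hne => if_neg (hj j hne)) (fun h => absurd (Finset.mem_range.2 hn) h), if_pos hi,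
        sub_self, traceNorm_zero]
    · refine Eventually.of_forall fun n => ?_
      push Not at hz
      simp [hz, traceNorm_zero]
  norm_univ := by simp [traceNorm_pureState hH hψ]

variable (hH : ¬ FiniteDimensional ℂ H) {ψ : H} (hψ : ‖ψ‖ = 1) (z : Z)

theorem traceNorm_diracState {S : Set Z} (hS : MeasurableSet S) :
    traceNorm ((diracState hH hψ z).toFun S) = Measure.dirac z S := by
  rw [Measure.dirac_apply' _ hS]
  by_cases h : z ∈ S <;> simp [diracState, h, traceNorm_zero, traceNorm_pureState hH hψ]

theorem isAtomic_diracState : (diracState hH hψ z).IsAtomic :=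
  ⟨{z}, by simp [diracState]⟩

variable [MeasurableSingletonClass Z]

theorem isRadonNikodym_diracState :
    IsRadonNikodym (diracState hH hψ z) (Measure.dirac z) fun _ => pureState ψ where
  norm_measure S hS := (traceNorm_diracState hH hψ z hS).symm
  measurable _ _ := measurable_const
  density := ae_of_all _ fun _ => isDensityMatrix_pureState hH hψ
  integral_eq S hS φ χ := by
    classical
    rw [setIntegral_dirac]
    by_cases h : z ∈ S <;> simp [diracState, h]

/-- A density is fixed only up to null sets, but the atom `z` is not null; integrating over the
whole space reads off `γ z`. -/
theorem IsRadonNikodym.of_diracState {hH : ¬ FiniteDimensional ℂ H} {ψ : H} {hψ : ‖ψ‖ = 1} {z : Z}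
    {μ : Measure Z} {γ : Z → (H →L[ℂ] H)} (h : IsRadonNikodym (diracState hH hψ z) μ γ) :
    μ = Measure.dirac z ∧ γ z = pureState ψ := by
  have hμ : μ = Measure.dirac z :=
    Measure.ext fun S hS => (h.norm_measure S hS).trans (traceNorm_diracState hH hψ z hS)
  refine ⟨hμ, ContinuousLinearMap.ext fun χ => ext_inner_left ℂ fun φ => ?_⟩
  have := h.integral_eq Set.univ MeasurableSet.univ φ χ
  rw [hμ, Measure.restrict_univ, integral_dirac] at this
  rw [← this]
  simp [diracState]

theorem svmFunctional_diracState {𝓔 : H → Z → EReal}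
    (h𝓔 : ∀ (c : ℂ) (φ : H) (z : Z), ‖c‖ = 1 → 𝓔 (c • φ) z = 𝓔 φ z) :
    svmFunctional 𝓔 (diracState hH hψ z) = 𝓔 ψ z := by
  apply le_antisymm
  · refine iInf_le_of_le _ <| iInf_le_of_le _ <|
      iInf_le_of_le (isRadonNikodym_diracState hH hψ z) ?_
    rw [extIntegral_dirac, traceForm_pureState hH (fun c φ hc => h𝓔 c φ z hc) hψ]
  · refine le_iInf fun μ => le_iInf fun γ => le_iInf fun h => ?_
    obtain ⟨rfl, hγ⟩ := h.of_diracState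
    rw [extIntegral_dirac, hγ, traceForm_pureState hH (fun c φ hc => h𝓔 c φ z hc) hψ]

end DiracState

/-! ### Bounded real-linear functionals and bilinear forms -/

section Bounded

variable {Z : Type*} [NormedAddCommGroup Z] [InnerProductSpace ℂ Z]

/-- A bounded real-linear functional on a complex normed space. -/
structure IsBddRealLinear (L : Z → ℝ) : Prop where
  map_add : ∀ z w, L (z + w) = L z + L w
  map_smul : ∀ (t : ℝ) z, L ((t : ℂ) • z) = t * L z
  bound : ∃ C, ∀ z, |L z| ≤ C * ‖z‖

namespace IsBddRealLinear

theorem zero : IsBddRealLinear (fun _ : Z => 0) :=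
  ⟨by simp, by simp, 0, by simp⟩

theorem add {L K : Z → ℝ} (hL : IsBddRealLinear L) (hK : IsBddRealLinear K) :
    IsBddRealLinear fun z => L z + K z := by
  obtain ⟨C, hC⟩ := hL.bound
  obtain ⟨D, hD⟩ := hK.bound
  refine ⟨fun z w => ?_, fun t z => ?_, C + D, fun z => ?_⟩
  · rw [hL.map_add, hK.map_add]; ring
  · rw [hL.map_smul, hK.map_smul]; ring
  · have := abs_add_le (L z) (K z)
    linarith [hC z, hD z]

theorem const_mul {L : Z → ℝ} (hL : IsBddRealLinear L) (c : ℝ) :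
    IsBddRealLinear fun z => c * L z := by
  obtain ⟨C, hC⟩ := hL.bound
  refine ⟨fun z w => ?_, fun t z => ?_, |c| * C, fun z => ?_⟩
  · rw [hL.map_add]; ring
  · rw [hL.map_smul]; ring
  · rw [abs_mul, mul_assoc]
    exact mul_le_mul_of_nonneg_left (hC z) (abs_nonneg c)

theorem sum {ι : Type*} (s : Finset ι) {L : ι → Z → ℝ} (hL : ∀ i ∈ s, IsBddRealLinear (L i)) :
    IsBddRealLinear fun z => ∑ i ∈ s, L i z := by
  classical
  induction s using Finset.induction_on with
  | empty => simpa using zero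
  | insert i s hi ih =>
    simp_rw [Finset.sum_insert hi]
    exact (hL i (Finset.mem_insert_self i s)).add
      (ih fun j hj => hL j (Finset.mem_insert_of_mem hj))

/-- The associated continuous linear functional. -/
def toCLM {L : Z → ℝ} (hL : IsBddRealLinear L) : Z →L[ℝ] ℝ :=
  LinearMap.mkContinuousOfExistsBound
    { toFun := L, map_add' := hL.map_add, map_smul' := fun t z => hL.map_smul t z } hL.bound

theorem toCLM_apply {L : Z → ℝ} (hL : IsBddRealLinear L) (z : Z) : hL.toCLM z = L z := rfl

end IsBddRealLinear

/-- A bounded nonnegative symmetric real-bilinear form. -/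
structure IsBddForm (B : Z → Z → ℝ) : Prop where
  linear : ∀ w, IsBddRealLinear fun z => B z w
  symm : ∀ z w, B z w = B w z
  nonneg : ∀ z, 0 ≤ B z z
  bound : ∃ C, ∀ z w, |B z w| ≤ C * ‖z‖ * ‖w‖

namespace IsBddForm

theorem zero : IsBddForm (fun _ _ : Z => 0) :=
  ⟨fun _ => .zero, by simp, by simp, 0, by simp⟩

theorem add {B B' : Z → Z → ℝ} (hB : IsBddForm B) (hB' : IsBddForm B') :
    IsBddForm fun z w => B z w + B' z w := by
  obtain ⟨C, hC⟩ := hB.bound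
  obtain ⟨D, hD⟩ := hB'.bound
  refine ⟨fun w => (hB.linear w).add (hB'.linear w), fun z w => ?_,
    fun z => add_nonneg (hB.nonneg z) (hB'.nonneg z), C + D, fun z w => ?_⟩
  · rw [hB.symm, hB'.symm]
  · have := abs_add_le (B z w) (B' z w)
    linarith [hC z w, hD z w]

theorem const_mul {B : Z → Z → ℝ} (hB : IsBddForm B) {c : ℝ} (hc : 0 ≤ c) :
    IsBddForm fun z w => c * B z w := by
  obtain ⟨C, hC⟩ := hB.bound
  refine ⟨fun w => (hB.linear w).const_mul c, fun z w => ?_,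
    fun z => mul_nonneg hc (hB.nonneg z), c * C, fun z w => ?_⟩
  · rw [hB.symm]
  · rw [abs_mul, abs_of_nonneg hc, mul_assoc, mul_assoc, ← mul_assoc C]
    exact mul_le_mul_of_nonneg_left (hC z w) hc

theorem sum {ι : Type*} (s : Finset ι) {B : ι → Z → Z → ℝ} (hB : ∀ i ∈ s, IsBddForm (B i)) :
    IsBddForm fun z w => ∑ i ∈ s, B i z w := by
  classical
  induction s using Finset.induction_on with
  | empty => simpa using zero
  | insert i s hi ih =>
    simp_rw [Finset.sum_insert hi]
    exact (hB i (Finset.mem_insert_self i s)).add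
      (ih fun j hj => hB j (Finset.mem_insert_of_mem hj))

theorem re_inner : IsBddForm fun z w : Z => (⟪z, w⟫_ℂ).re where
  linear w := by
    refine ⟨fun z z' => by simp, fun t z => by simp, ‖w‖,
      fun z => ?_⟩
    rw [mul_comm]
    exact (Complex.abs_re_le_norm _).trans (norm_inner_le_norm z w)
  symm z w := inner_re_symm (𝕜 := ℂ) z w
  nonneg z := inner_self_nonneg (𝕜 := ℂ)
  bound := ⟨1, fun z w => by
    rw [one_mul]
    exact (Complex.abs_re_le_norm _).trans (norm_inner_le_norm z w)⟩

theorem map_smul_smul {B : Z → Z → ℝ} (hB : IsBddForm B) (t : ℝ) (z : Z) :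
    B ((t : ℂ) • z) ((t : ℂ) • z) = t ^ 2 * B z z := by
  rw [(hB.linear _).map_smul, hB.symm, (hB.linear _).map_smul]
  ring

theorem map_add_add {B : Z → Z → ℝ} (hB : IsBddForm B) (z w : Z) :
    B (z + w) (z + w) = B z z + 2 * B z w + B w w := by
  rw [(hB.linear _).map_add, hB.symm z, hB.symm w (z + w), (hB.linear _).map_add,
    (hB.linear _).map_add, hB.symm w z]
  ring

/-- The associated continuous bilinear map. -/
def toCLM {B : Z → Z → ℝ} (hB : IsBddForm B) : Z →L[ℝ] Z →L[ℝ] ℝ :=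
  LinearMap.mkContinuousOfExistsBound₂
    (LinearMap.mk₂ ℝ B (fun z z' w => (hB.linear w).map_add z z')
      (fun t z w => (hB.linear w).map_smul t z)
      (fun z w w' => by rw [hB.symm, (hB.linear z).map_add, hB.symm w, hB.symm w'])
      (fun t z w => by
        rw [hB.symm, hB.symm z w]
        exact (hB.linear z).map_smul t w))
    hB.bound

theorem toCLM_apply {B : Z → Z → ℝ} (hB : IsBddForm B) (z w : Z) : hB.toCLM z w = B z w := rfl

/-- Lax–Milgram: the Euler–Lagrange equation of `z ↦ A + L z + B z z` has a solution if `B` is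
coercive. -/
theorem exists_solution [CompleteSpace Z] {B : Z → Z → ℝ} (hB : IsBddForm B)
    (hcoer : ∀ z, ‖z‖ ^ 2 ≤ B z z) {L : Z → ℝ} (hL : IsBddRealLinear L) :
    ∃ z₀, ∀ z, L z + 2 * B z₀ z = 0 := by
  -- The functionals are only real-linear, so Lax–Milgram is applied over `ℝ`.
  let _ : InnerProductSpace ℝ Z := InnerProductSpace.complexToReal
  have hc : IsCoercive hB.toCLM := ⟨1, one_pos, fun z => by
    rw [toCLM_apply]
    linarith [hcoer z, sq ‖z‖]⟩
  -- With this factor, `B z₀ = K` is the equation `L + 2 B z₀ = 0`.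
  let K : Z →L[ℝ] ℝ := (-(1 / 2 : ℝ)) • hL.toCLM
  refine ⟨hc.continuousLinearEquivOfBilin.symm ((InnerProductSpace.toDual ℝ Z).symm K), fun z => ?_⟩
  have h := hc.continuousLinearEquivOfBilin_apply
    (hc.continuousLinearEquivOfBilin.symm ((InnerProductSpace.toDual ℝ Z).symm K)) z
  rw [ContinuousLinearEquiv.apply_symm_apply, InnerProductSpace.toDual_symm_apply,
    toCLM_apply] at h
  rw [← h]
  simp [K, IsBddRealLinear.toCLM_apply]

end IsBddForm

end Bounded

/-! ### Functionals quadratic in the field: all energies agree -/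

section Coincidence

variable {Z : Type*} [NormedAddCommGroup Z] [InnerProductSpace ℂ Z]
variable {H : Type*} [NormedAddCommGroup H] [InnerProductSpace ℂ H]

/-- A functional of a wave function and a field which is invariant under a change of phase of the
wave function and which, for every normalized wave function, is either identically `⊤` or a
quadratic polynomial in the field whose leading part dominates the square of the norm. -/
structure IsQuadraticInField (𝓔 : H → Z → EReal) : Prop where
  phase : ∀ (c : ℂ) (ψ : H) (z : Z), ‖c‖ = 1 → 𝓔 (c • ψ) z = 𝓔 ψ z
  quadratic : ∀ ψ, ‖ψ‖ = 1 → (∀ z, 𝓔 ψ z = ⊤) ∨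
    ∃ (A : ℝ) (L : Z → ℝ) (B : Z → Z → ℝ), IsBddRealLinear L ∧ IsBddForm B ∧
      ∀ z, 𝓔 ψ z = ((A + L z + B z z + ‖z‖ ^ 2 : ℝ) : EReal)

variable {𝓔 : H → Z → EReal}

omit [NormedAddCommGroup H] [InnerProductSpace ℂ H] in
/-- A coercive quadratic polynomial of the field has a critical point, and its critical points are
its minimizers. -/
theorem exists_isCriticalField_and_le [CompleteSpace Z] {ψ : H} {A : ℝ} {L : Z → ℝ}
    {B : Z → Z → ℝ} (hL : IsBddRealLinear L) (hB : IsBddForm B)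
    (h : ∀ z, 𝓔 ψ z = ((A + L z + B z z + ‖z‖ ^ 2 : ℝ) : EReal)) :
    (∃ z, IsCriticalField 𝓔 ψ z) ∧ ∀ z, IsCriticalField 𝓔 ψ z → ∀ w, 𝓔 ψ z ≤ 𝓔 ψ w := by
  have hB' : IsBddForm fun z w => B z w + (⟪z, w⟫_ℂ).re := hB.add .re_inner
  set F : Z → Z → ℝ := fun z w => B z w + (⟪z, w⟫_ℂ).re with hF
  have hnorm (z : Z) : (⟪z, z⟫_ℂ).re = ‖z‖ ^ 2 := inner_self_eq_norm_sq (𝕜 := ℂ) z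
  have hE (z : Z) : 𝓔 ψ z = ((A + L z + F z z : ℝ) : EReal) := by
    rw [h, hF]
    simp only [hnorm, add_assoc]
  have hcoer (z : Z) : ‖z‖ ^ 2 ≤ F z z := by
    simp only [hF, hnorm]
    linarith [hB.nonneg z]
  have hexp (z ζ : Z) (t : ℝ) : A + L (z + (t : ℂ) • ζ) + F (z + (t : ℂ) • ζ) (z + (t : ℂ) • ζ) =
      (A + L z + F z z) + t * (L ζ + 2 * F z ζ) + t ^ 2 * F ζ ζ := by
    rw [hL.map_add, hL.map_smul, hB'.map_add_add, hB'.map_smul_smul, hB'.symm z ((t : ℂ) • ζ),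
      (hB'.linear z).map_smul, hB'.symm ζ z]
    ring
  have hderiv (z ζ : Z) : HasDerivAt (fun t : ℝ => (𝓔 ψ (z + (t : ℂ) • ζ)).toReal)
      (L ζ + 2 * F z ζ) 0 := by
    simp only [hE, EReal.toReal_coe, hexp]
    have h1 := (hasDerivAt_id (0 : ℝ)).mul_const (L ζ + 2 * F z ζ)
    have h2 := (hasDerivAt_pow 2 (0 : ℝ)).mul_const (F ζ ζ)
    exact ((h1.const_add (A + L z + F z z)).fun_add h2).congr_deriv (by simp)
  constructor
  · obtain ⟨z₀, hz₀⟩ := hB'.exists_solution hcoer hL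
    exact ⟨z₀, fun ζ => hz₀ ζ ▸ hderiv z₀ ζ⟩
  · intro z hz w
    -- The expansion is exact: at a critical point the linear term vanishes, and at `t = 1` the
    -- excess energy is `F (w - z) (w - z) ≥ 0`.
    have h0 := (hz (w - z)).unique (hderiv z (w - z))
    have h1 := hexp z (w - z) 1
    rw [Complex.ofReal_one, one_smul, add_sub_cancel, ← h0] at h1
    rw [hE, hE, EReal.coe_le_coe_iff, h1]
    linarith [hcoer (w - z), sq_nonneg ‖w - z‖]

namespace IsQuadraticInField

variable [CompleteSpace Z] (h𝓔 : IsQuadraticInField 𝓔)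
include h𝓔

theorem pekarImplicit_eq {ψ : H} (hψ : ‖ψ‖ = 1) :
    pekarImplicitFunctional 𝓔 ψ = pekarFunctional 𝓔 ψ := by
  apply le_antisymm
  · refine le_iInf fun w => ?_
    rcases h𝓔.quadratic ψ hψ with h | ⟨A, L, B, hL, hB, h⟩
    · rw [h]
      exact le_top
    · obtain ⟨⟨z, hz⟩, hmin⟩ := exists_isCriticalField_and_le hL hB h
      exact iInf_le_of_le z <| iInf_le_of_le hz (hmin z hz w)
  · exact le_iInf fun z => le_iInf fun _ => iInf_le _ z

/-- Attainment of the minimum excludes the value `⊥`, so every `ψ` admissible for `qcEnergy` is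
admissible for the Pekar problem. -/
theorem isFinite_pekar {ψ : H} (hψ : ‖ψ‖ = 1) {z : Z} (hz : IsFinite (𝓔 ψ z)) :
    IsFinite (pekarFunctional 𝓔 ψ) := by
  rcases h𝓔.quadratic ψ hψ with h | ⟨A, L, B, hL, hB, h⟩
  · exact absurd (h z) hz.1
  · obtain ⟨⟨z₀, hz₀⟩, hmin⟩ := exists_isCriticalField_and_le hL hB h
    have : pekarFunctional 𝓔 ψ = 𝓔 ψ z₀ := le_antisymm (iInf_le _ z₀) (le_iInf (hmin z₀ hz₀))
    rw [this, h]
    exact ⟨EReal.coe_ne_top _, EReal.coe_ne_bot _⟩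

omit [CompleteSpace Z] in
-- The finiteness constraint costs nothing: a value that is not finite can only be `⊤`.
theorem qcEnergy_le {ψ : H} (hψ : ‖ψ‖ = 1) (z : Z) : qcEnergy 𝓔 ≤ 𝓔 ψ z := by
  by_cases hz : IsFinite (𝓔 ψ z)
  · exact iInf_le_of_le ψ <| iInf_le_of_le z <| iInf_le_of_le hψ <| iInf_le_of_le hz le_rfl
  · rcases h𝓔.quadratic ψ hψ with h | ⟨A, L, B, hL, hB, h⟩
    · rw [h]
      exact le_top
    · rw [h] at hz
      exact absurd ⟨EReal.coe_ne_top _, EReal.coe_ne_bot _⟩ hz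

omit [CompleteSpace Z] in
theorem qcEnergy_le_svmFunctional [MeasurableSpace Z] [CompleteSpace H]
    (𝔪 : StateValuedMeasure Z H) : qcEnergy 𝓔 ≤ svmFunctional 𝓔 𝔪 := by
  refine le_iInf fun μ => le_iInf fun γ => le_iInf fun h => ?_
  -- The norm measure has total mass one by normalization of `𝔪`.
  have : IsProbabilityMeasure μ := ⟨(h.norm_measure _ .univ).trans 𝔪.norm_univ⟩
  rw [← extIntegral_const μ (qcEnergy 𝓔)]
  refine extIntegral_mono (h.density.mono fun z hz => ?_)
  exact le_traceForm hz fun p ψ hp k _ => h𝓔.qcEnergy_le (hp.orthonormal.1 k) z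

omit [CompleteSpace Z] in
theorem qcEnergy_le_pmFunctional [MeasurableSpace Z] {ψ : H} (hψ : ‖ψ‖ = 1) (μ : Measure Z)
    [IsProbabilityMeasure μ] : qcEnergy 𝓔 ≤ pmFunctional 𝓔 ψ μ := by
  rw [← extIntegral_const μ (qcEnergy 𝓔)]
  exact extIntegral_mono (ae_of_all _ fun z => h𝓔.qcEnergy_le hψ z)

/-- All variational problems attached to a functional that is quadratic in the field have the same
infimum. -/
theorem energiesCoincide [MeasurableSpace Z] [BorelSpace Z] [CompleteSpace H]
    (hH : ¬ FiniteDimensional ℂ H) : EnergiesCoincide 𝓔 := by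
  have hsvm : svmEnergy 𝓔 = qcEnergy 𝓔 := by
    apply le_antisymm
    · refine le_iInf fun ψ => le_iInf fun z => le_iInf fun hψ => le_iInf fun hf => ?_
      have h := svmFunctional_diracState hH hψ z h𝓔.phase
      exact iInf_le_of_le (diracState hH hψ z) <| iInf_le_of_le (h ▸ hf) h.le
    · exact le_iInf fun 𝔪 => le_iInf fun _ => h𝓔.qcEnergy_le_svmFunctional 𝔪
  have hsvma : svmAtomicEnergy 𝓔 = qcEnergy 𝓔 := by
    apply le_antisymm
    · refine le_iInf fun ψ => le_iInf fun z => le_iInf fun hψ => le_iInf fun hf => ?_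
      have h := svmFunctional_diracState hH hψ z h𝓔.phase
      exact iInf_le_of_le (diracState hH hψ z) <|
        iInf_le_of_le (isAtomic_diracState hH hψ z) <| iInf_le_of_le (h ▸ hf) h.le
    · exact le_iInf fun 𝔪 => le_iInf fun _ => le_iInf fun _ => h𝓔.qcEnergy_le_svmFunctional 𝔪
  have hpm : pmEnergy 𝓔 = qcEnergy 𝓔 := by
    apply le_antisymm
    · refine le_iInf fun ψ => le_iInf fun z => le_iInf fun hψ => le_iInf fun hf => ?_
      have h : pmFunctional 𝓔 ψ (Measure.dirac z) = 𝓔 ψ z := extIntegral_dirac z _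
      exact iInf_le_of_le ψ <| iInf_le_of_le (Measure.dirac z) <| iInf_le_of_le hψ <|
        iInf_le_of_le inferInstance <| iInf_le_of_le (h ▸ hf) h.le
    · exact le_iInf fun ψ => le_iInf fun μ => le_iInf fun hψ => le_iInf fun _ => le_iInf fun _ =>
        h𝓔.qcEnergy_le_pmFunctional hψ μ
  have hpma : pmAtomicEnergy 𝓔 = qcEnergy 𝓔 := by
    apply le_antisymm
    · refine le_iInf fun ψ => le_iInf fun z => le_iInf fun hψ => le_iInf fun hf => ?_
      have h : pmFunctional 𝓔 ψ (Measure.dirac z) = 𝓔 ψ z := extIntegral_dirac z _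
      exact iInf_le_of_le ψ <| iInf_le_of_le (Measure.dirac z) <| iInf_le_of_le hψ <|
        iInf_le_of_le inferInstance <| iInf_le_of_le ⟨{z}, by simp⟩ <|
        iInf_le_of_le (h ▸ hf) h.le
    · exact le_iInf fun ψ => le_iInf fun μ => le_iInf fun hψ => le_iInf fun _ => le_iInf fun _ =>
        le_iInf fun _ => h𝓔.qcEnergy_le_pmFunctional hψ μ
  have hpek : waveEnergy (pekarFunctional 𝓔) = qcEnergy 𝓔 := by
    apply le_antisymm
    · refine le_iInf fun ψ => le_iInf fun z => le_iInf fun hψ => le_iInf fun hf => ?_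
      exact iInf_le_of_le ψ <| iInf_le_of_le hψ <|
        iInf_le_of_le (h𝓔.isFinite_pekar hψ hf) (iInf_le _ z)
    · exact le_iInf fun ψ => le_iInf fun hψ => le_iInf fun _ => le_iInf fun z =>
        h𝓔.qcEnergy_le hψ z
  have himpl : waveEnergy (pekarImplicitFunctional 𝓔) = waveEnergy (pekarFunctional 𝓔) := by
    refine iInf_congr fun ψ => iInf_congr fun hψ => ?_
    rw [h𝓔.pekarImplicit_eq hψ]
  have hfield : ⨅ z, fieldFunctional 𝓔 z = qcEnergy 𝓔 := by
    apply le_antisymm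
    · exact le_iInf fun ψ => le_iInf fun z => le_iInf fun hψ => le_iInf fun _ =>
        iInf_le_of_le z <| iInf_le_of_le ψ <| iInf_le_of_le hψ le_rfl
    · exact le_iInf fun z => le_iInf fun ψ => le_iInf fun hψ => h𝓔.qcEnergy_le hψ z
  refine ⟨hsvm.symm, ?_, ?_, ?_, ?_, ?_, ?_⟩
  · rw [hsvm, hsvma]
  · rw [hsvma, hpm]
  · rw [hpm, hpma]
  · rw [hpma, hpek]
  · rw [himpl]
  · rw [himpl, hpek, hfield]

end IsQuadraticInField

end Coincidence

/-! ### Couplings by bounded functions -/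

section BoundedFields

variable {Z : Type*} [NormedAddCommGroup Z] [InnerProductSpace ℂ Z]
variable {X Y : Type*} [MeasurableSpace X] [MeasurableSpace Y] {μ : Measure X} {ν : Measure Y}

/-- A bounded real-linear map from fields to bounded real functions. -/
structure IsBddField (μ : Measure X) (a : Z → X → ℝ) : Prop where
  aestronglyMeasurable : ∀ z, AEStronglyMeasurable (a z) μ
  map_add : ∀ z w, ∀ᵐ x ∂μ, a (z + w) x = a z x + a w x
  map_smul : ∀ (t : ℝ) z, ∀ᵐ x ∂μ, a ((t : ℂ) • z) x = t * a z x
  bound : ∃ C, 0 ≤ C ∧ ∀ z, ∀ᵐ x ∂μ, |a z x| ≤ C * ‖z‖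

namespace IsBddField

variable {a : Z → X → ℝ}

theorem comp (ha : IsBddField μ a) {f : Y → X} (hf : Measure.QuasiMeasurePreserving f ν μ) :
    IsBddField ν fun z y => a z (f y) where
  aestronglyMeasurable z := (ha.aestronglyMeasurable z).comp_quasiMeasurePreserving hf
  map_add z w := hf.ae (ha.map_add z w)
  map_smul t z := hf.ae (ha.map_smul t z)
  bound := by
    obtain ⟨C, hC, h⟩ := ha.bound
    exact ⟨C, hC, fun z => hf.ae (h z)⟩

theorem integrable_mul (ha : IsBddField μ a) {w : X → ℝ} (hw : Integrable w μ) (z : Z) :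
    Integrable (fun x => a z x * w x) μ := by
  obtain ⟨C, -, h⟩ := ha.bound
  exact hw.bdd_mul (ha.aestronglyMeasurable z) (h z)

theorem abs_integral_mul_le {C : ℝ} (ha : IsBddField μ a) (hC : ∀ z, ∀ᵐ x ∂μ, |a z x| ≤ C * ‖z‖)
    {w : X → ℝ} (hw : Integrable w μ) (z : Z) :
    |∫ x, a z x * w x ∂μ| ≤ (C * ∫ x, |w x| ∂μ) * ‖z‖ := by
  calc |∫ x, a z x * w x ∂μ| ≤ ∫ x, |a z x * w x| ∂μ := abs_integral_le_integral_abs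
    _ ≤ ∫ x, C * ‖z‖ * |w x| ∂μ := by
        refine integral_mono_ae (ha.integrable_mul hw z).abs (hw.abs.const_mul _) ?_
        filter_upwards [hC z] with x hx
        rw [abs_mul]
        exact mul_le_mul_of_nonneg_right hx (abs_nonneg _)
    _ = (C * ∫ x, |w x| ∂μ) * ‖z‖ := by
        rw [integral_const_mul]
        ring

theorem isBddRealLinear (ha : IsBddField μ a) {w : X → ℝ} (hw : Integrable w μ) :
    IsBddRealLinear fun z => ∫ x, a z x * w x ∂μ where
  map_add z z' := by
    rw [← integral_add (ha.integrable_mul hw z) (ha.integrable_mul hw z')]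
    refine integral_congr_ae ?_
    filter_upwards [ha.map_add z z'] with x hx
    rw [hx]
    ring
  map_smul t z := by
    rw [← integral_const_mul]
    refine integral_congr_ae ?_
    filter_upwards [ha.map_smul t z] with x hx
    rw [hx]
    ring
  bound := by
    obtain ⟨C, -, h⟩ := ha.bound
    exact ⟨_, ha.abs_integral_mul_le h hw⟩

/-- Fixing one field and absorbing `a z'` into the weight reduces this to the linear case, since `a
z' * w` is again integrable. -/
theorem isBddForm (ha : IsBddField μ a) {w : X → ℝ} (hw : Integrable w μ) (hw0 : ∀ x, 0 ≤ w x) :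
    IsBddForm fun z z' => ∫ x, a z x * (a z' x * w x) ∂μ where
  linear z' := ha.isBddRealLinear (ha.integrable_mul hw z')
  symm z z' := by
    refine integral_congr_ae (ae_of_all _ fun x => ?_)
    ring
  nonneg z := by
    refine integral_nonneg fun x => ?_
    simp only [Pi.zero_apply, ← mul_assoc]
    exact mul_nonneg (mul_self_nonneg _) (hw0 x)
  bound := by
    obtain ⟨C, hC, h⟩ := ha.bound
    refine ⟨C * (C * ∫ x, |w x| ∂μ), fun z z' => ?_⟩
    refine (ha.abs_integral_mul_le h (ha.integrable_mul hw z') z).trans ?_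
    have h1 : ∫ x, |a z' x * w x| ∂μ ≤ (C * ∫ x, |w x| ∂μ) * ‖z'‖ := by
      calc ∫ x, |a z' x * w x| ∂μ ≤ ∫ x, C * ‖z'‖ * |w x| ∂μ := by
            refine integral_mono_ae (ha.integrable_mul hw z').abs (hw.abs.const_mul _) ?_
            filter_upwards [h z'] with x hx
            rw [abs_mul]
            exact mul_le_mul_of_nonneg_right hx (abs_nonneg _)
        _ = (C * ∫ x, |w x| ∂μ) * ‖z'‖ := by
            rw [integral_const_mul]
            ring
    calc C * (∫ x, |a z' x * w x| ∂μ) * ‖z‖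
        ≤ C * ((C * ∫ x, |w x| ∂μ) * ‖z'‖) * ‖z‖ := by gcongr
      _ = C * (C * ∫ x, |w x| ∂μ) * ‖z‖ * ‖z'‖ := by ring

end IsBddField

end BoundedFields

/-! ### Particle space, weak gradients and phases -/

section Particles

variable {d N : ℕ}

/-- A surjective linear map pushes Haar measure to a multiple of Haar measure. The multiple may be
infinite, but null sets still pull back to null sets, which is what almost everywhere bounds
require. -/
theorem quasiMeasurePreserving_position (j : Fin N) :
    Measure.QuasiMeasurePreserving (position (d := d) j) volume volume := by
  let P : Config d N →ₗ[ℝ] Space d :=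
    { toFun := position j
      map_add' := fun X Y => rfl
      map_smul' := fun t X => rfl }
  have hsurj : Function.Surjective P := by
    intro x
    refine ⟨WithLp.toLp 2 fun a => x a.2, ?_⟩
    ext l
    rfl
  have hmeas : Measurable (position (d := d) j) :=
    (LinearMap.continuous_of_finiteDimensional P).measurable
  refine ⟨hmeas, ?_⟩
  obtain ⟨c, -, hc⟩ := P.exists_map_addHaar_eq_smul_addHaar volume volume hsurj
  change Measure.map P volume ≪ volume
  rw [hc]
  exact Measure.smul_absolutelyContinuous

/-- `L²(ℝ^{dN})` is infinite dimensional. -/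
theorem not_finiteDimensional_particleSpace (hd : 1 ≤ d) (hN : 1 ≤ N) :
    ¬ FiniteDimensional ℂ (ParticleSpace d N) := by
  have : Nonempty (Fin N × Fin d) := ⟨⟨⟨0, hN⟩, ⟨0, hd⟩⟩⟩
  let a : Fin N × Fin d := ⟨⟨0, hN⟩, ⟨0, hd⟩⟩
  let c (n : ℕ) : Config d N := EuclideanSpace.single a (n : ℝ)
  let s (n : ℕ) : Set (Config d N) := Metric.ball (c n) (1 / 2)
  have hs (n : ℕ) : MeasurableSet (s n) := measurableSet_ball
  have hfin (n : ℕ) : volume (s n) ≠ ⊤ := measure_ball_lt_top.ne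
  have hpos (n : ℕ) : volume (s n) ≠ 0 := (Metric.measure_ball_pos _ _ (by norm_num)).ne'
  have hdisj (m n : ℕ) (h : m ≠ n) : Disjoint (s m) (s n) := by
    apply Metric.ball_disjoint_ball
    have h1 : dist (c m) (c n) = |(m : ℝ) - n| := by
      rw [PiLp.dist_single_same, Real.dist_eq]
    have h2 : (1 : ℝ) ≤ |(m : ℝ) - n| := by
      have : (1 : ℤ) ≤ |(m : ℤ) - n| := Int.one_le_abs (by omega)
      exact_mod_cast this
    rw [h1]
    linarith
  let v (n : ℕ) : ParticleSpace d N := indicatorConstLp 2 (hs n) (hfin n) 1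
  have hv0 (n : ℕ) : v n ≠ 0 := by
    intro h
    have h1 := norm_indicatorConstLp (hs := hs n) (hμs := hfin n) (c := (1 : ℂ)) (p := 2)
      (by norm_num) (by norm_num)
    change ‖v n‖ = _ at h1
    rw [h, norm_zero, norm_one, one_mul] at h1
    have h2 : 0 < volume.real (s n) := ENNReal.toReal_pos (hpos n) (hfin n)
    exact (Real.rpow_pos_of_pos h2 _).ne h1
  have horth : Pairwise fun m n => ⟪v m, v n⟫_ℂ = 0 := by
    intro m n hmn
    rw [L2.inner_indicatorConstLp_one_indicatorConstLp_one, (hdisj m n hmn).inter_eq]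
    simp
  have hli : LinearIndependent ℂ v := linearIndependent_of_ne_zero_of_inner_eq_zero hv0 horth
  intro hf
  exact not_finite_iff_infinite.2 (inferInstance : Infinite ℕ) hli.finite

/-- Two locally integrable functions with the same integrals against test functions agree almost
everywhere. Uniqueness makes the chosen `weakGrad` compatible with scalars, as phase invariance
requires. -/
theorem IsWeakGradient.unique {ψ : ParticleSpace d N} {G G' : Fin N × Fin d → ParticleSpace d N}
    (hG : IsWeakGradient ψ G) (hG' : IsWeakGradient ψ G') : G = G' := by
  funext a
  apply Lp.ext
  refine ae_eq_of_integral_contDiff_smul_eq ((Lp.memLp (G a)).locallyIntegrable (by norm_num))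
    ((Lp.memLp (G' a)).locallyIntegrable (by norm_num)) fun φ hφ hφ' => ?_
  have h := (hG a φ hφ hφ').symm.trans (hG' a φ hφ hφ')
  simpa [mul_comm] using h

theorem IsWeakGradient.smul {ψ : ParticleSpace d N} {G : Fin N × Fin d → ParticleSpace d N}
    (hG : IsWeakGradient ψ G) (c : ℂ) : IsWeakGradient (c • ψ) (c • G) := by
  intro a φ hφ hφ'
  have h := congrArg (c * ·) (hG a φ hφ hφ')
  simp only [mul_neg, ← integral_const_mul] at h
  refine Eq.trans (integral_congr_ae ?_) (h.trans (congrArg _ (integral_congr_ae ?_)))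
  · filter_upwards [Lp.coeFn_smul c ψ] with X hX
    rw [hX, Pi.smul_apply, smul_eq_mul, mul_assoc]
  · filter_upwards [Lp.coeFn_smul c (G a)] with X hX
    rw [Pi.smul_apply, hX, Pi.smul_apply, smul_eq_mul, mul_assoc]

theorem MemH1.isWeakGradient {ψ : ParticleSpace d N} (h : MemH1 ψ) :
    IsWeakGradient ψ (weakGrad ψ) := by
  rw [weakGrad, dif_pos h]
  exact h.choose_spec

theorem MemH1.smul {ψ : ParticleSpace d N} (h : MemH1 ψ) (c : ℂ) : MemH1 (c • ψ) :=
  ⟨_, h.isWeakGradient.smul c⟩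

theorem MemH1.weakGrad_smul {ψ : ParticleSpace d N} (h : MemH1 ψ) (c : ℂ) :
    weakGrad (c • ψ) = c • weakGrad ψ :=
  (h.smul c).isWeakGradient.unique (h.isWeakGradient.smul c)

theorem ae_smul_eq (c : ℂ) (ψ : ParticleSpace d N) : ∀ᵐ X, (c • ψ) X = c * ψ X := by
  filter_upwards [Lp.coeFn_smul c ψ] with X hX
  rw [hX, Pi.smul_apply, smul_eq_mul]

theorem ae_norm_smul_eq {c : ℂ} (hc : ‖c‖ = 1) (ψ : ParticleSpace d N) :
    ∀ᵐ X, ‖(c • ψ) X‖ = ‖ψ X‖ := by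
  filter_upwards [ae_smul_eq c ψ] with X hX
  rw [hX, norm_mul, hc, one_mul]

theorem Potential.FormDomain.smul {V : Potential d N} {ψ : ParticleSpace d N}
    (h : V.FormDomain ψ) {c : ℂ} (hc : ‖c‖ = 1) : V.FormDomain (c • ψ) := by
  refine ⟨h.1.smul c, h.2.congr ?_⟩
  filter_upwards [ae_norm_smul_eq hc ψ] with X hX
  rw [hX]

theorem Potential.formDomain_smul_iff (V : Potential d N) (ψ : ParticleSpace d N) {c : ℂ}
    (hc : ‖c‖ = 1) : V.FormDomain (c • ψ) ↔ V.FormDomain ψ := by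
  refine ⟨fun h => ?_, fun h => h.smul hc⟩
  have h0 : c ≠ 0 := norm_ne_zero_iff.1 (by rw [hc]; exact one_ne_zero)
  have := h.smul (c := c⁻¹) (by rw [norm_inv, hc, inv_one])
  rwa [smul_smul, inv_mul_cancel₀ h0, one_smul] at this

theorem Potential.energy_smul (V : Potential d N) (ψ : ParticleSpace d N) {c : ℂ}
    (hc : ‖c‖ = 1) : V.energy (c • ψ) = V.energy ψ := by
  refine integral_congr_ae ?_
  filter_upwards [ae_norm_smul_eq hc ψ] with X hX
  rw [hX]

theorem integral_mul_norm_smul_sq (f : Config d N → ℝ) (ψ : ParticleSpace d N) {c : ℂ}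
    (hc : ‖c‖ = 1) : ∫ X, f X * ‖(c • ψ) X‖ ^ 2 = ∫ X, f X * ‖ψ X‖ ^ 2 := by
  refine integral_congr_ae ?_
  filter_upwards [ae_norm_smul_eq hc ψ] with X hX
  rw [hX]

theorem integrable_norm_sq (ψ : ParticleSpace d N) : Integrable fun X => ‖ψ X‖ ^ 2 :=
  (memLp_two_iff_integrable_sq_norm (Lp.aestronglyMeasurable ψ)).1 (Lp.memLp ψ)

theorem integrable_re_conj_mul (ψ φ : ParticleSpace d N) :
    Integrable fun X => ((starRingEnd ℂ) (ψ X) * φ X).re := by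
  have := (L2.integrable_inner (𝕜 := ℂ) ψ φ).re
  refine this.congr (ae_of_all _ fun X => ?_)
  simp [mul_comm]

end Particles

/-! ### The pairing between `𝔥_ω` and form factors -/

section Pairing

variable {𝔥 : Type*} [NormedAddCommGroup 𝔥] [InnerProductSpace ℂ 𝔥] [CompleteSpace 𝔥]
  {ω : Dispersion 𝔥}

theorem IsSqrt.symmetric {S : 𝔥 →ₗ.[ℂ] 𝔥} (hS : IsSqrt S ω) {u v u' v' : 𝔥}
    (h : (u, v) ∈ S.graph) (h' : (u', v') ∈ S.graph) : ⟪v, u'⟫_ℂ = ⟪u, v'⟫_ℂ := by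
  have hadj := LinearPMap.adjoint_isFormalAdjoint (T := S) hS.selfAdjoint.dense_domain
  rw [LinearPMap.isSelfAdjoint_def.1 hS.selfAdjoint] at hadj
  obtain ⟨x, rfl, rfl⟩ := (LinearPMap.mem_graph_iff S).1 h
  obtain ⟨y, rfl, rfl⟩ := (LinearPMap.mem_graph_iff S).1 h'
  exact hadj x y

theorem Dispersion.norm_sq (u : ω.Smooth) :
    ‖u‖ ^ 2 = (⟪(ω.toDomain u : 𝔥), ω.op (ω.toDomain u)⟫_ℂ).re :=
  (inner_self_eq_norm_sq (𝕜 := ℂ) u).symm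

/-- With `f = S g`, symmetry gives `⟨u|f⟩ = ⟨S u|g⟩`, and `‖S u‖` is the norm of `u` in `𝔥_ω`
because `S` squares to `ω`. -/
theorem IsSqrt.norm_inner_le {S : 𝔥 →ₗ.[ℂ] 𝔥} (hS : IsSqrt S ω) {f g : 𝔥}
    (hgf : (g, f) ∈ S.graph) (u : ω.Smooth) :
    ‖⟪(ω.toDomain u : 𝔥), f⟫_ℂ‖ ≤ ‖g‖ * ‖u‖ := by
  obtain ⟨v, h1, h2⟩ := (hS.sq _ _).1 (ω.op.mem_graph (ω.toDomain u))
  have hv : ‖v‖ = ‖u‖ := by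
    have h3 := hS.symmetric h1 h2
    rw [← sq_eq_sq₀ (norm_nonneg _) (norm_nonneg _), ω.norm_sq, ← h3]
    exact (inner_self_eq_norm_sq (𝕜 := ℂ) v).symm
  rw [← hS.symmetric h1 hgf, ← hv, mul_comm]
  exact norm_inner_le_norm v g

/-- The functional `u ↦ ⟨u|f⟩` is bounded by `C` for the norm of `𝔥_ω`. -/
def Dispersion.DualBound (ω : Dispersion 𝔥) (f : 𝔥) (C : ℝ) : Prop :=
  ∀ u : ω.Smooth, ‖⟪(ω.toDomain u : 𝔥), f⟫_ℂ‖ ≤ C * ‖u‖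

namespace Dispersion.DualBound

variable {f : 𝔥} {C : ℝ} (h : ω.DualBound f C)
include h

theorem uniformContinuous : UniformContinuous fun u : ω.Smooth => ⟪(ω.toDomain u : 𝔥), f⟫_ℂ := by
  let T : ω.Smooth →ₗ⋆[ℂ] ℂ :=
    { toFun := fun u => ⟪(ω.toDomain u : 𝔥), f⟫_ℂ
      map_add' := fun u v => by simp
      map_smul' := fun c u => by simp [mul_comm] }
  exact (T.mkContinuous C h).uniformContinuous

theorem pairing_coe (u : ω.Smooth) : ω.pairing u f = ⟪(ω.toDomain u : 𝔥), f⟫_ℂ :=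
  UniformSpace.Completion.extension_coe h.uniformContinuous u

-- No bound on `f` is needed: `UniformSpace.Completion.extension` is always continuous.
omit h in
theorem continuous_pairing : Continuous fun z => ω.pairing z f :=
  UniformSpace.Completion.continuous_extension

theorem pairing_add (z w : ω.FieldSpace) :
    ω.pairing (z + w) f = ω.pairing z f + ω.pairing w f := by
  induction z, w using UniformSpace.Completion.induction_on₂ with
  | hp =>
    exact isClosed_eq (continuous_pairing.comp (continuous_fst.add continuous_snd))
      ((continuous_pairing.comp continuous_fst).add (continuous_pairing.comp continuous_snd))
  | ih u v =>
    rw [← UniformSpace.Completion.coe_add, h.pairing_coe, h.pairing_coe, h.pairing_coe]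
    simp

theorem pairing_smul (c : ℂ) (z : ω.FieldSpace) :
    ω.pairing (c • z) f = (starRingEnd ℂ) c * ω.pairing z f := by
  induction z using UniformSpace.Completion.induction_on with
  | hp =>
    exact isClosed_eq (continuous_pairing.comp (continuous_const_smul c))
      (continuous_const.mul continuous_pairing)
  | ih u =>
    rw [← UniformSpace.Completion.coe_smul, h.pairing_coe, h.pairing_coe]
    simp [mul_comm]

theorem norm_pairing_le (z : ω.FieldSpace) : ‖ω.pairing z f‖ ≤ C * ‖z‖ := by
  induction z using UniformSpace.Completion.induction_on with
  | hp => exact isClosed_le continuous_pairing.norm (continuous_const.mul continuous_norm)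
  | ih u =>
    rw [h.pairing_coe, UniformSpace.Completion.norm_coe]
    exact h u

end Dispersion.DualBound

theorem InvSqrtBounded.exists_dualBound {d : ℕ} {f : Space d → 𝔥} (h : InvSqrtBounded ω f) :
    ∃ C, 0 ≤ C ∧ ∀ᵐ x, ω.DualBound (f x) C := by
  obtain ⟨S, g, hS, hg, hgf⟩ := h
  refine ⟨(eLpNormEssSup g volume).toReal, ENNReal.toReal_nonneg, ?_⟩
  have hfin : eLpNormEssSup g volume ≠ ⊤ := by
    have := hg.2.ne
    rwa [eLpNorm_exponent_top] at this
  filter_upwards [hgf, enorm_ae_le_eLpNormEssSup g volume] with x hx hgx u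
  refine (hS.norm_inner_le hx u).trans (mul_le_mul_of_nonneg_right ?_ (norm_nonneg _))
  rw [← toReal_enorm]
  exact ENNReal.toReal_mono hfin hgx

theorem InvSqrtBounded.isBddField {d : ℕ} {f : Space d → 𝔥} (h : InvSqrtBounded ω f)
    (hf : AEStronglyMeasurable f volume) :
    IsBddField volume fun (z : ω.FieldSpace) x => 2 * (ω.pairing z (f x)).re := by
  obtain ⟨C, hC, hb⟩ := h.exists_dualBound
  refine ⟨fun z => ?_, fun z w => ?_, fun t z => ?_, 2 * C, by positivity, fun z => ?_⟩
  -- Measurability in `x`: approximating `z` from the dense subspace makes the pairing an almost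
  -- everywhere limit of measurable inner products.
  · obtain ⟨u, hmem, hu⟩ := mem_closure_iff_seq_limit.1
      ((UniformSpace.Completion.denseRange_coe (α := ω.Smooth)) z)
    choose v hv using hmem
    have hm : AEStronglyMeasurable (fun x => ω.pairing z (f x)) volume := by
      refine aestronglyMeasurable_of_tendsto_ae atTop
        (f := fun n x => ⟪(ω.toDomain (v n) : 𝔥), f x⟫_ℂ) (fun n => ?_) ?_
      · exact aestronglyMeasurable_const.inner hf
      · filter_upwards [hb] with x hx
        simp_rw [← hx.pairing_coe, hv]
        exact (Dispersion.DualBound.continuous_pairing.tendsto z).comp hu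
    exact (Complex.continuous_re.comp_aestronglyMeasurable hm).const_mul 2
  · filter_upwards [hb] with x hx
    rw [hx.pairing_add, Complex.add_re]
    ring
  · filter_upwards [hb] with x hx
    rw [hx.pairing_smul]
    simp
    ring
  · filter_upwards [hb] with x hx
    rw [abs_mul, abs_two, mul_assoc]
    exact mul_le_mul_of_nonneg_left
      ((Complex.abs_re_le_norm _).trans (hx.norm_pairing_le z)) zero_le_two

end Pairing

/-! ### The Nelson model -/

theorem NelsonModel.isQuadraticInField {𝔥 : Type*} [NormedAddCommGroup 𝔥] [InnerProductSpace ℂ 𝔥]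
    [CompleteSpace 𝔥] {d N : ℕ} (M : NelsonModel 𝔥 d N) : IsQuadraticInField M.energy where
  phase c ψ z hc := by
    by_cases h : M.potential.FormDomain ψ
    · rw [NelsonModel.energy, NelsonModel.energy, if_pos (h.smul hc), if_pos h]
      simp only [M.potential.energy_smul ψ hc, h.1.weakGrad_smul, integral_mul_norm_smul_sq _ ψ hc,
        Pi.smul_apply, norm_smul, hc, one_mul]
    · rw [NelsonModel.energy, NelsonModel.energy, if_neg h,
        if_neg (mt (M.potential.formDomain_smul_iff ψ hc).1 h)]
  quadratic ψ hψ := by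
    by_cases h : M.potential.FormDomain ψ
    · right
      have hL : IsBddRealLinear fun z : M.ω.FieldSpace =>
          ∑ j, ∫ X, 2 * (M.ω.pairing z (M.lam (position j X))).re * ‖ψ X‖ ^ 2 :=
        .sum _ fun j _ => ((M.invSqrt.isBddField M.memLp.1).comp
          (quasiMeasurePreserving_position j)).isBddRealLinear (integrable_norm_sq ψ)
      refine ⟨(∑ a, ‖weakGrad ψ a‖ ^ 2) + M.potential.energy ψ, _, _, hL, .zero, fun z => ?_⟩
      rw [NelsonModel.energy, if_pos h, hψ, one_pow, mul_one, add_zero]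
    · left
      intro z
      rw [NelsonModel.energy, if_neg h]

/-! ### The polaron -/

section Polaron

variable {d N : ℕ}

/-- The integral operator with kernel `K(k) e^{-ik·x}` restricted to `k ∈ s`, applied to the complex
conjugate of a field. -/
def planeWaveIntegral (s : Set (Space d)) (K : Space d → ℝ) (z : PolaronField d) (x : Space d) : ℂ :=
  ∫ k in s, (starRingEnd ℂ) (z k) * (K k : ℂ) * Complex.exp (-(Complex.I * (⟪k, x⟫_ℝ : ℂ)))

section PlaneWave

variable {s : Set (Space d)} {K : Space d → ℝ}

/-- The plane wave `K(k) e^{-ik·x}` restricted to `k ∈ s`. -/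
def planeWave (s : Set (Space d)) (K : Space d → ℝ) (x k : Space d) : ℂ :=
  s.indicator (fun k => (K k : ℂ) * Complex.exp (-(Complex.I * (⟪k, x⟫_ℝ : ℂ)))) k

theorem norm_planeWave (x k : Space d) :
    ‖planeWave s K x k‖ = ‖s.indicator K k‖ := by
  by_cases hk : k ∈ s
  · simp [planeWave, hk, Complex.norm_exp]
  · simp [planeWave, hk]

theorem memLp_planeWave (hs : MeasurableSet s) (hKm : Measurable K)
    (hK : MemLp K 2 (volume.restrict s)) (x : Space d) : MemLp (planeWave s K x) 2 volume := by
  refine ((memLp_indicator_iff_restrict hs).2 hK).congr_norm ?_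
    (ae_of_all _ fun k => (norm_planeWave x k).symm)
  refine (Measurable.indicator ?_ hs).aestronglyMeasurable
  fun_prop

variable (hs : MeasurableSet s) (hKm : Measurable K) (hK : MemLp K 2 (volume.restrict s))
include hs hKm hK

/-- As an inner product with an `L²` plane wave, the integral inherits linearity and Cauchy–Schwarz;
the bound is uniform in `x` because the modulus of the wave does not depend on `x`. -/
theorem planeWaveIntegral_eq_inner (z : PolaronField d) (x : Space d) :
    planeWaveIntegral s K z x = ⟪z, (memLp_planeWave hs hKm hK x).toLp⟫_ℂ := by
  rw [planeWaveIntegral, L2.inner_def, ← integral_indicator hs]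
  refine integral_congr_ae ?_
  filter_upwards [(memLp_planeWave hs hKm hK x).coeFn_toLp] with k hk
  rw [hk]
  by_cases hks : k ∈ s
  · simp [planeWave, hks]
    ring
  · simp [planeWave, hks]

theorem planeWaveIntegral_add (z w : PolaronField d) (x : Space d) :
    planeWaveIntegral s K (z + w) x = planeWaveIntegral s K z x + planeWaveIntegral s K w x := by
  simp only [planeWaveIntegral_eq_inner hs hKm hK, inner_add_left]

theorem planeWaveIntegral_smul (t : ℝ) (z : PolaronField d) (x : Space d) :
    planeWaveIntegral s K ((t : ℂ) • z) x = t * planeWaveIntegral s K z x := by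
  simp only [planeWaveIntegral_eq_inner hs hKm hK, inner_smul_left, Complex.conj_ofReal]

theorem norm_planeWaveIntegral_le (z : PolaronField d) (x : Space d) :
    ‖planeWaveIntegral s K z x‖ ≤ (eLpNorm (s.indicator K) 2 volume).toReal * ‖z‖ := by
  rw [planeWaveIntegral_eq_inner hs hKm hK, mul_comm]
  refine (norm_inner_le_norm _ _).trans_eq ?_
  rw [Lp.norm_toLp, eLpNorm_congr_norm_ae (ae_of_all _ (norm_planeWave x))]

omit hs hK in
theorem stronglyMeasurable_planeWaveIntegral (z : PolaronField d) :
    StronglyMeasurable (planeWaveIntegral s K z) := by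
  refine StronglyMeasurable.integral_prod_right (f := fun x k : Space d =>
    (starRingEnd ℂ) (z k) * (K k : ℂ) * Complex.exp (-(Complex.I * (⟪k, x⟫_ℝ : ℂ)))) ?_
  have hz : Measurable z := (Lp.stronglyMeasurable z).measurable
  refine Measurable.stronglyMeasurable ?_
  simp only [Function.uncurry_def]
  have h1 : Measurable fun p : Space d × Space d => (starRingEnd ℂ) (z p.2) :=
    Complex.continuous_conj.measurable.comp (hz.comp measurable_snd)
  fun_prop

theorem isBddField_re_planeWaveIntegral (c : ℝ) :
    IsBddField volume fun (z : PolaronField d) x => c * (planeWaveIntegral s K z x).re where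
  aestronglyMeasurable z := (Complex.continuous_re.comp_stronglyMeasurable
    (stronglyMeasurable_planeWaveIntegral hKm z)).aestronglyMeasurable.const_mul c
  map_add z w := ae_of_all _ fun x => by
    rw [planeWaveIntegral_add hs hKm hK, Complex.add_re, mul_add]
  map_smul t z := ae_of_all _ fun x => by
    rw [planeWaveIntegral_smul hs hKm hK, Complex.re_ofReal_mul]
    ring
  bound := ⟨|c| * (eLpNorm (s.indicator K) 2 volume).toReal, by positivity, fun z =>
    ae_of_all _ fun x => by
      rw [abs_mul, mul_assoc]
      exact mul_le_mul_of_nonneg_left ((Complex.abs_re_le_norm _).trans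
        (norm_planeWaveIntegral_le hs hKm hK z x)) (abs_nonneg c)⟩

theorem isBddField_im_planeWaveIntegral (c : ℝ) :
    IsBddField volume fun (z : PolaronField d) x => c * (planeWaveIntegral s K z x).im where
  aestronglyMeasurable z := (Complex.continuous_im.comp_stronglyMeasurable
    (stronglyMeasurable_planeWaveIntegral hKm z)).aestronglyMeasurable.const_mul c
  map_add z w := ae_of_all _ fun x => by
    rw [planeWaveIntegral_add hs hKm hK, Complex.add_im, mul_add]
  map_smul t z := ae_of_all _ fun x => by
    rw [planeWaveIntegral_smul hs hKm hK, Complex.im_ofReal_mul]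
    ring
  bound := ⟨|c| * (eLpNorm (s.indicator K) 2 volume).toReal, by positivity, fun z =>
    ae_of_all _ fun x => by
      rw [abs_mul, mul_assoc]
      exact mul_le_mul_of_nonneg_left ((Complex.abs_im_le_norm _).trans
        (norm_planeWaveIntegral_le hs hKm hK z x)) (abs_nonneg c)⟩

end PlaneWave

/-- A radial function on `ℝ^d` is in `L²` on a spherically symmetric set if its square is integrable
in polar coordinates. -/
theorem memLp_two_radial (hd : 1 ≤ d) {f : ℝ → ℝ} (hf : Measurable f) {I : Set ℝ}
    (hI : MeasurableSet I) (h : IntegrableOn (fun r => r ^ (d - 1) * f r ^ 2) (I ∩ Set.Ioi 0)) :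
    MemLp (fun k : Space d => f ‖k‖) 2 (volume.restrict {k | ‖k‖ ∈ I}) := by
  have : Nonempty (Fin d) := ⟨⟨0, hd⟩⟩
  have hm : Measurable fun k : Space d => f ‖k‖ := hf.comp measurable_norm
  rw [memLp_two_iff_integrable_sq hm.aestronglyMeasurable]
  have hs : MeasurableSet {k : Space d | ‖k‖ ∈ I} := measurable_norm hI
  rw [← IntegrableOn, ← integrable_indicator_iff hs]
  have h1 : Integrable (fun k : Space d => I.indicator (fun r => f r ^ 2) ‖k‖) volume := by
    rw [integrable_fun_norm_addHaar, finrank_euclideanSpace_fin]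
    rw [← integrable_indicator_iff (hI.inter measurableSet_Ioi)] at h
    rw [← integrable_indicator_iff measurableSet_Ioi]
    refine h.congr (ae_of_all _ fun r => ?_)
    by_cases h1 : r ∈ I <;> by_cases h2 : 0 < r <;> simp [Set.indicator, h1, h2]
  exact h1

/-- The Jacobian `r ^ (d - 1)` cancels the squared kernel exactly, leaving a constant on a bounded
interval. -/
theorem memLp_lowKernel (hd : 1 ≤ d) (α ϱ : ℝ) :
    MemLp (fun k : Space d => Real.sqrt α * ‖k‖ ^ (-((d : ℝ) - 1) / 2)) 2
      (volume.restrict {k | ‖k‖ ≤ ϱ}) := by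
  refine (memLp_two_radial hd (f := fun r : ℝ => r ^ (-((d : ℝ) - 1) / 2)) (by fun_prop)
    (I := Set.Iic ϱ) measurableSet_Iic ?_).const_mul (Real.sqrt α)
  have h1 : IntegrableOn (fun _ : ℝ => (1 : ℝ)) (Set.Iic ϱ ∩ Set.Ioi 0) := by
    rw [Set.inter_comm, Set.Ioi_inter_Iic]
    exact integrableOn_const (by simp)
  refine h1.congr_fun (fun r hr => ?_) (measurableSet_Iic.inter measurableSet_Ioi)
  have hr0 : 0 < r := hr.2
  have hcast : ((d - 1 : ℕ) : ℝ) = (d : ℝ) - 1 := by push_cast [Nat.cast_sub hd]; ring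
  simp only
  rw [← Real.rpow_natCast, ← Real.rpow_natCast, ← Real.rpow_mul hr0.le, ← Real.rpow_add hr0, hcast,
    show (d : ℝ) - 1 + -((d : ℝ) - 1) / 2 * ((2 : ℕ) : ℝ) = 0 by push_cast; ring, Real.rpow_zero]

/-- The divergence form gains one power of `|k|`: in polar coordinates the squared radial kernel
becomes `r ^ (-2)`, integrable away from zero. The directional factor is at most one. -/
theorem memLp_highKernel (hd : 1 ≤ d) (α : ℝ) {ϱ : ℝ} (hϱ : 0 < ϱ) (l : Fin d) :
    MemLp (fun k : Space d => Real.sqrt α * ‖k‖ ^ (-((d : ℝ) + 1) / 2) * (k l / ‖k‖)) 2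
      (volume.restrict {k | ϱ < ‖k‖}) := by
  have h : MemLp (fun k : Space d => Real.sqrt α * ‖k‖ ^ (-((d : ℝ) + 1) / 2)) 2
      (volume.restrict {k | ϱ < ‖k‖}) := by
    refine (memLp_two_radial hd (f := fun r : ℝ => r ^ (-((d : ℝ) + 1) / 2)) (by fun_prop)
      (I := Set.Ioi ϱ) measurableSet_Ioi ?_).const_mul (Real.sqrt α)
    have h1 : IntegrableOn (fun r : ℝ => r ^ (-2 : ℝ)) (Set.Ioi ϱ ∩ Set.Ioi 0) :=
      (integrableOn_Ioi_rpow_of_lt (by norm_num) hϱ).mono_set Set.inter_subset_left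
    refine h1.congr_fun (fun r hr => ?_) (measurableSet_Ioi.inter measurableSet_Ioi)
    have hr0 : 0 < r := hr.2
    have hcast : ((d - 1 : ℕ) : ℝ) = (d : ℝ) - 1 := by push_cast [Nat.cast_sub hd]; ring
    simp only
    rw [← Real.rpow_natCast r (d - 1), ← Real.rpow_natCast _ 2, ← Real.rpow_mul hr0.le,
      ← Real.rpow_add hr0, hcast]
    congr 1
    push_cast
    ring
  refine h.mono (Measurable.aestronglyMeasurable (by fun_prop)) (ae_of_all _ fun k => ?_)
  rw [norm_mul _ (k l / ‖k‖), norm_div, norm_norm]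
  exact mul_le_of_le_one_right (norm_nonneg _)
    (div_le_one_of_le₀ (PiLp.norm_apply_le k l) (norm_nonneg _))

theorem PolaronModel.isBddField_lowPotential (hd : 1 ≤ d) (M : PolaronModel d N) :
    IsBddField volume M.lowPotential :=
  isBddField_re_planeWaveIntegral (measurableSet_le measurable_norm measurable_const)
    (by fun_prop) (memLp_lowKernel hd M.α M.ϱ) 2

theorem PolaronModel.isBddField_highField (hd : 1 ≤ d) (M : PolaronModel d N) (l : Fin d) :
    IsBddField volume fun z x => M.highField z l x :=
  isBddField_im_planeWaveIntegral (measurableSet_lt measurable_const measurable_norm)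
    (by fun_prop) (memLp_highKernel hd M.α M.ϱ_pos l) (-2)

theorem PolaronModel.isQuadraticInField (hd : 1 ≤ d) (M : PolaronModel d N) :
    IsQuadraticInField M.energy where
  phase c ψ z hc := by
    by_cases h : M.potential.FormDomain ψ
    · rw [PolaronModel.energy, PolaronModel.energy, if_pos (h.smul hc), if_pos h]
      have hgrad (j : Fin N) (l : Fin d) :
          ∫ X, M.highField z l (position j X) *
            ((starRingEnd ℂ) ((c • ψ) X) * (c • weakGrad ψ (j, l)) X).re =
          ∫ X, M.highField z l (position j X) *
            ((starRingEnd ℂ) (ψ X) * weakGrad ψ (j, l) X).re := by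
        refine integral_congr_ae ?_
        filter_upwards [ae_smul_eq c ψ, ae_smul_eq c (weakGrad ψ (j, l))] with X h1 h2
        have hcc : (starRingEnd ℂ) c * c = 1 := by
          rw [Complex.conj_mul', hc]
          simp
        rw [h1, h2, map_mul, mul_mul_mul_comm, hcc, one_mul]
      simp only [M.potential.energy_smul ψ hc, h.1.weakGrad_smul, integral_mul_norm_smul_sq _ ψ hc,
        Pi.smul_apply, norm_smul, hc, one_mul, hgrad]
    · rw [PolaronModel.energy, PolaronModel.energy, if_neg h,
        if_neg (mt (M.potential.formDomain_smul_iff ψ hc).1 h)]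
  quadratic ψ hψ := by
    by_cases h : M.potential.FormDomain ψ
    · right
      have hlow (j : Fin N) : IsBddRealLinear fun z =>
          ∫ X, M.lowPotential z (position j X) * ‖ψ X‖ ^ 2 :=
        ((M.isBddField_lowPotential hd).comp
          (quasiMeasurePreserving_position j)).isBddRealLinear (integrable_norm_sq ψ)
      have hhigh (j : Fin N) (l : Fin d) : IsBddRealLinear fun z =>
          ∫ X, M.highField z l (position j X) *
            ((starRingEnd ℂ) (ψ X) * weakGrad ψ (j, l) X).re :=
        ((M.isBddField_highField hd l).comp
          (quasiMeasurePreserving_position j)).isBddRealLinear (integrable_re_conj_mul _ _)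
      have hL : IsBddRealLinear fun z => ∑ j, ((∫ X, M.lowPotential z (position j X) * ‖ψ X‖ ^ 2)
          + (-2) * ∑ l, ∫ X, M.highField z l (position j X) *
            ((starRingEnd ℂ) (ψ X) * weakGrad ψ (j, l) X).re) :=
        .sum _ fun j _ => (hlow j).add ((IsBddRealLinear.sum _ fun l _ => hhigh j l).const_mul _)
      refine ⟨(∑ a, ‖weakGrad ψ a‖ ^ 2) + M.potential.energy ψ, _, _, hL, .zero, fun z => ?_⟩
      rw [PolaronModel.energy, if_pos h, hψ, one_pow, mul_one, add_zero]
      simp only [neg_mul, ← sub_eq_add_neg]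
    · left
      intro z
      rw [PolaronModel.energy, if_neg h]

end Polaron

/-! ### The Pauli–Fierz model -/

section PauliFierz

theorem norm_neg_I_mul_add_sq (r : ℝ) (a b : ℂ) :
    ‖-Complex.I * a + (r : ℂ) * b‖ ^ 2 =
      ‖a‖ ^ 2 + r * (2 * ((starRingEnd ℂ) b * (-Complex.I * a)).re) + r * (r * ‖b‖ ^ 2) := by
  simp only [← Complex.normSq_eq_norm_sq, Complex.normSq_apply]
  simp
  ring

variable {𝔥 : Type*} [NormedAddCommGroup 𝔥] [InnerProductSpace ℂ 𝔥] [CompleteSpace 𝔥] {N : ℕ}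

theorem PauliFierzModel.isBddField_vectorPotential (M : PauliFierzModel 𝔥 N) (j : Fin N)
    (l : Fin 3) : IsBddField volume fun (z : M.ω.FieldSpace) (X : Config 3 N) =>
      M.vectorPotential z j l (position j X) :=
  ((M.invSqrt j l).isBddField (M.memLp j l).1).comp (quasiMeasurePreserving_position j)

/-- Expanding the square sorts the kinetic energy by degree in the field. Boundedness of the vector
potential makes each term integrable, so the integral splits. -/
theorem PauliFierzModel.integral_kinetic (M : PauliFierzModel 𝔥 N) (ψ G : ParticleSpace 3 N)
    (z : M.ω.FieldSpace) (j : Fin N) (l : Fin 3) :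
    ∫ X, ‖-Complex.I * G X + ((M.e * M.vectorPotential z j l (position j X) : ℝ) : ℂ) * ψ X‖ ^ 2 =
      (∫ X, ‖G X‖ ^ 2)
      + M.e * (∫ X, M.vectorPotential z j l (position j X) *
          (2 * ((starRingEnd ℂ) (ψ X) * (-Complex.I * G X)).re))
      + M.e ^ 2 * ∫ X, M.vectorPotential z j l (position j X) *
          (M.vectorPotential z j l (position j X) * ‖ψ X‖ ^ 2) := by
  have ha := M.isBddField_vectorPotential j l
  have h1 : Integrable fun X => ((starRingEnd ℂ) (ψ X) * (-Complex.I * G X)).re := by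
    refine (integrable_re_conj_mul ψ (-Complex.I • G)).congr ?_
    filter_upwards [ae_smul_eq (-Complex.I) G] with X hX
    rw [hX]
  have h2 := (ha.integrable_mul (h1.const_mul 2) z).const_mul M.e
  have h3 := (ha.integrable_mul (ha.integrable_mul (integrable_norm_sq ψ) z) z).const_mul (M.e ^ 2)
  rw [← integral_const_mul, ← integral_const_mul, ← integral_add (integrable_norm_sq G) h2,
    ← integral_add (by exact (integrable_norm_sq G).add h2) h3]
  refine integral_congr_ae (ae_of_all _ fun X => ?_)
  simp only [norm_neg_I_mul_add_sq]
  ring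

theorem PauliFierzModel.isQuadraticInField (M : PauliFierzModel 𝔥 N) :
    IsQuadraticInField M.energy where
  phase c ψ z hc := by
    by_cases h : M.potential.FormDomain ψ
    · rw [PauliFierzModel.energy, PauliFierzModel.energy, if_pos (h.smul hc), if_pos h]
      have hkin (j : Fin N) (l : Fin 3) :
          ∫ X, ‖-Complex.I * (c • weakGrad ψ (j, l)) X +
            ((M.e * M.vectorPotential z j l (position j X) : ℝ) : ℂ) * (c • ψ) X‖ ^ 2 =
          ∫ X, ‖-Complex.I * weakGrad ψ (j, l) X +
            ((M.e * M.vectorPotential z j l (position j X) : ℝ) : ℂ) * ψ X‖ ^ 2 := by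
        refine integral_congr_ae ?_
        filter_upwards [ae_smul_eq c ψ, ae_smul_eq c (weakGrad ψ (j, l))] with X h1 h2
        rw [h1, h2, mul_left_comm, mul_left_comm _ c, ← mul_add, norm_mul, hc, one_mul]
      simp only [M.potential.energy_smul ψ hc, h.1.weakGrad_smul, Pi.smul_apply, norm_smul, hc,
        one_mul, hkin]
    · rw [PauliFierzModel.energy, PauliFierzModel.energy, if_neg h,
        if_neg (mt (M.potential.formDomain_smul_iff ψ hc).1 h)]
  quadratic ψ hψ := by
    by_cases h : M.potential.FormDomain ψ
    · right
      have hint (j : Fin N) (l : Fin 3) : Integrable fun X =>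
          2 * ((starRingEnd ℂ) (ψ X) * (-Complex.I * weakGrad ψ (j, l) X)).re := by
        refine ((integrable_re_conj_mul ψ (-Complex.I • weakGrad ψ (j, l))).congr ?_).const_mul 2
        filter_upwards [ae_smul_eq (-Complex.I) (weakGrad ψ (j, l))] with X hX
        rw [hX]
      have hL : IsBddRealLinear fun z : M.ω.FieldSpace =>
          ∑ j, (1 / (2 * M.mass j)) * ∑ l, M.e *
            ∫ X, M.vectorPotential z j l (position j X) *
              (2 * ((starRingEnd ℂ) (ψ X) * (-Complex.I * weakGrad ψ (j, l) X)).re) :=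
        .sum _ fun j _ => (IsBddRealLinear.sum _ fun l _ =>
          ((M.isBddField_vectorPotential j l).isBddRealLinear (hint j l)).const_mul _).const_mul _
      -- Polarization of the term quadratic in the vector potential; it is nonnegative because the
      -- masses are positive.
      have hB : IsBddForm fun z z' : M.ω.FieldSpace =>
          ∑ j, (1 / (2 * M.mass j)) * ∑ l, M.e ^ 2 *
            ∫ X, M.vectorPotential z j l (position j X) *
              (M.vectorPotential z' j l (position j X) * ‖ψ X‖ ^ 2) :=
        .sum _ fun j _ => (IsBddForm.sum _ fun l _ =>
          ((M.isBddField_vectorPotential j l).isBddForm (integrable_norm_sq ψ)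
            fun X => sq_nonneg _).const_mul (sq_nonneg _)).const_mul
              (by have := M.mass_pos j; positivity)
      refine ⟨(∑ j, (1 / (2 * M.mass j)) * ∑ l, ∫ X, ‖weakGrad ψ (j, l) X‖ ^ 2)
        + M.potential.energy ψ, _, _, hL, hB, fun z => ?_⟩
      rw [PauliFierzModel.energy, if_pos h, hψ, one_pow, mul_one]
      simp only [M.integral_kinetic, Finset.sum_add_distrib, mul_add]
      congr 1
      ring
    · left
      intro z
      rw [PauliFierzModel.energy, if_neg h]

end PauliFierz

end QuasiClassical

end

/-! ### Conclusion for the three models -/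

theorem mainTheorem9 (d N : ℕ) (hd : 1 ≤ d) (hd' : d ≤ 3) (hN : 1 ≤ N) :
    (∀ (𝔥 : Type*) [NormedAddCommGroup 𝔥] [InnerProductSpace ℂ 𝔥] [CompleteSpace 𝔥]
      [TopologicalSpace.SeparableSpace 𝔥] (M : QuasiClassical.NelsonModel 𝔥 d N),
      QuasiClassical.EnergiesCoincide M.energy) ∧
    (∀ M : QuasiClassical.PolaronModel d N, QuasiClassical.EnergiesCoincide M.energy) ∧
    (∀ (𝔥 : Type*) [NormedAddCommGroup 𝔥] [InnerProductSpace ℂ 𝔥] [CompleteSpace 𝔥]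
      [TopologicalSpace.SeparableSpace 𝔥] (M : QuasiClassical.PauliFierzModel 𝔥 N),
      QuasiClassical.EnergiesCoincide M.energy) := by
  have hH := QuasiClassical.not_finiteDimensional_particleSpace hd hN
  have hH3 := QuasiClassical.not_finiteDimensional_particleSpace (d := 3) (by norm_num) hN
  exact ⟨fun 𝔥 _ _ _ _ M => M.isQuadraticInField.energiesCoincide hH,
    fun M => (M.isQuadraticInField hd).energiesCoincide hH,
    fun 𝔥 _ _ _ _ M => M.isQuadraticInField.energiesCoincide hH3⟩
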